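/- Let $F$ be a probability distribution on $[0,\infty)$, let $\overline{F}=1-F$ be its tail, and let $\overline{F*F}(t)=P(X+Y>t)$, where $X,Y$ are independent with distribution $F$. Assume that $\overline{F}(t)=e^{-\alpha t+\chi(t)}$ for all $t\ge 0$, where $\alpha>0$ and $\chi:[0,\infty)\to\mathbb{R}$ is differentiable on some half-line $(t_0,\infty)$ with $\chi'$ nonincreasing there. Assume further that $\chi\in 2RV_{\rho,\rho_1}$ with auxiliary function $A_1$, where $0<\rho<1$ and $\rho+\rho_1<0$; that is, $\chi$ is measurable and eventually positive, $A_1$ is eventually positive or eventually negative, $A_1(t)\to 0$ as $t\to\infty$, and for every $x>0$ \[\lim_{t\to\infty}\frac{\chi(tx)/\chi(t)-x^{\rho}}{A_1(t)}=x^{\rho}\,\frac{x^{\rho_1}-1}{\rho_1}.\] Then, as $t\to\infty$, \[\frac{\chi^{1/2}(t/2)\,\overline{F*F}(t)}{t\,\overline{F}^{2}(t/2)}=\frac{\alpha}{2}\sqrt{\frac{\pi}{\rho(1-\rho)}}-\frac{2^{\rho-5}\alpha\sqrt{\pi}\,(\rho-2)(\rho-3)}{(\rho(1-\rho))^{3/2}\,\chi(t)}-\frac{1}{2^{\rho}}\sqrt{\frac{\rho\pi}{1-\rho}}\,\frac{\chi(t)}{t}+o\!\left(|A_1(t)|\,\chi(t)+\frac{1}{\chi(t)}+\frac{\chi^{1/2}(t)}{t}\right).\]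 -/

import Mathlib

open MeasureTheory Filter Asymptotics
open scoped Topology

/-- The tail (survival function) `t ↦ 1 - F(t) = P(X > t)` of a distribution on the line. -/
noncomputable def distTail (μ : Measure ℝ) (t : ℝ) : ℝ :=
  μ.real (Set.Ioi t)

/-- `(x ^ r - 1) / r`, read as `log x` when `r = 0`. -/
noncomputable def powQuot (r x : ℝ) : ℝ :=
  if r = 0 then Real.log x else (x ^ r - 1) / r

/-- `χ` is of second-order regular variation with first-order parameter `a`, second-order
parameter `r ≤ 0` and auxiliary function `A`. Only the values of `χ` on `[0, ∞)` matter. -/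
structure IsSecondOrderRV (χ : ℝ → ℝ) (a r : ℝ) (A : ℝ → ℝ) : Prop where
  measurable : Measurable fun x : Set.Ici (0 : ℝ) => χ x
  eventually_pos : ∀ᶠ t in atTop, 0 < χ t
  param_nonpos : r ≤ 0
  aux_sign : (∀ᶠ t in atTop, 0 < A t) ∨ (∀ᶠ t in atTop, A t < 0)
  aux_tendsto : Tendsto A atTop (𝓝 0)
  tendsto : ∀ x : ℝ, 0 < x →
    Tendsto (fun t => (χ (t * x) / χ t - x ^ a) / A t) atTop (𝓝 (x ^ a * powQuot r x))

/-!
Write `u = t / 2`, `V = χ u`. Splitting `X + Y > 2 u` at `u` and integrating by parts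
(`abs_distTail_conv_self_sub_le`, `abs_convRatio_sub_integral_le`) gives
`P(X + Y > 2 u) / P(X > u) ^ 2 = ∫ (2 α - χ' (u + s) - χ' (u - s)) exp (g s) ds` over
`0 ≤ s ≤ u - T`, up to an exponentially small error, where
`g s = χ (u + s) + χ (u - s) - 2 χ u` is decreasing by concavity. The symmetry of the integrand is
exact: the would-be correction of order `√χ / t` cancels.

After scaling `s = u y`, only `y` near `0` matters. There second-order regular variation holds
uniformly (`IsSecondOrderRV.tendsto_prod`), and since its limit vanishes at `x = 1`, it gives
`χ (u (1 ± y)) = V (1 ± y) ^ ρ + o(|A| V)`. So in the factor `exp g` the function `χ` may be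
replaced by the pure power, with error `o(|A| V)`, which is small because `ρ + ρ₁ < 0`. The
derivatives `χ'` are not controlled pointwise to this precision; but
`χ' (u + u y) + χ' (u - u y)` is a derivative in `y`, so an integration by parts moves the
comparison back to `χ` itself (`abs_integral_deriv_mul_exp_le`).

What remains is a Laplace integral with the even exponent `V ((1 + y) ^ ρ + (1 - y) ^ ρ - 2)`,
whose expansion to fourth order in `y` produces the constant term and the `1 / χ` term
(`tendsto_laplace_second_order`); the leading contribution of `χ'` is the `χ / t` term. Finally
regular variation translates `χ (t / 2)` into `χ t`.
-/

/-! ### Regular variation -/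

/-- The engine behind the uniform convergence theorems: if the number `d i` is bounded, for every
`y ∈ [1, 2]`, by `|G i (x i * y)| + |K i y|` with `G i` and `K i` tending to `0` only pointwise and
`x i → 1`, then `d i → 0`. Integrate the truncation `min 1 |·|` over `y ∈ [1, 2]` and substitute
`x i * y`; dominated convergence replaces the usual appeal to Egorov's theorem. -/
theorem tendsto_zero_of_translation_bound {ι : Type*} {l : Filter ι} [l.IsCountablyGenerated]
    {d x : ι → ℝ} {G K : ι → ℝ → ℝ} (hx : Tendsto x l (𝓝 1))
    (hG : ∀ y ∈ Set.Icc (1 / 2 : ℝ) 4, Tendsto (fun i => G i y) l (𝓝 0))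
    (hGc : ∀ᶠ i in l, ContinuousOn (G i) (Set.Icc (1 / 2) 4))
    (hK : ∀ y ∈ Set.Icc (1 : ℝ) 2, Tendsto (fun i => K i y) l (𝓝 0))
    (hKc : ∀ᶠ i in l, ContinuousOn (K i) (Set.Icc 1 2))
    (hd : ∀ᶠ i in l, ∀ y ∈ Set.Icc (1 : ℝ) 2, |d i| ≤ |G i (x i * y)| + |K i y|) :
    Tendsto d l (𝓝 0) := by
  have key : ∀ (a b : ℝ) (hab : a ≤ b) (F : ι → ℝ → ℝ),
      (∀ y ∈ Set.Icc a b, Tendsto (fun i => F i y) l (𝓝 0)) →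
      (∀ᶠ i in l, ContinuousOn (F i) (Set.Icc a b)) →
      Tendsto (fun i => ∫ y in a..b, min 1 |F i y|) l (𝓝 0) := by
    intro a b hab F hF hFc
    have h0 : (0 : ℝ) = ∫ y in a..b, (0 : ℝ) := by simp
    rw [h0]
    refine intervalIntegral.tendsto_integral_filter_of_dominated_convergence (fun _ => 1) ?_ ?_ ?_ ?_
    · filter_upwards [hFc] with i hi
      rw [Set.uIoc_of_le hab]
      refine ContinuousOn.aestronglyMeasurable ?_ measurableSet_Ioc
      exact (continuousOn_const.inf (hi.abs)).mono Set.Ioc_subset_Icc_self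
    · filter_upwards with i
      filter_upwards with y _
      rw [Real.norm_of_nonneg (le_min zero_le_one (abs_nonneg _))]
      exact min_le_left _ _
    · simp
    · filter_upwards with y hy
      rw [Set.uIoc_of_le hab] at hy
      have := (tendsto_const_nhds (x := (1 : ℝ))).min (hF y (Set.Ioc_subset_Icc_self hy)).abs
      simpa using this
  have h1 := key (1 / 2) 4 (by norm_num) G hG hGc
  have h2 := key 1 2 (by norm_num) K hK hKc
  -- `min 1 |d i|` is its own mean over `[1, 2]`
  have h3 : Tendsto (fun i => min 1 |d i|) l (𝓝 0) := by
    refine squeeze_zero' (Eventually.of_forall fun i => le_min zero_le_one (abs_nonneg _)) ?_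
      (g := fun i => 2 * (∫ y in (1 / 2 : ℝ)..4, min 1 |G i y|) + ∫ y in (1 : ℝ)..2, min 1 |K i y|)
      (by simpa using (h1.const_mul 2).add h2)
    have hx1 : ∀ᶠ i in l, 1 / 2 < x i := hx.eventually_const_lt (by norm_num)
    have hx2 : ∀ᶠ i in l, x i < 2 := hx.eventually_lt_const (by norm_num)
    filter_upwards [hx1, hx2, hGc, hKc, hd] with i hx1 hx2 hGc hKc hd
    have hxp : 0 < x i := by linarith
    have cG : ContinuousOn (fun y => min 1 |G i y|) (Set.Icc (1 / 2) 4) :=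
      continuousOn_const.inf hGc.abs
    have cK : ContinuousOn (fun y => min 1 |K i y|) (Set.Icc 1 2) :=
      continuousOn_const.inf hKc.abs
    have cG' : ContinuousOn (fun y => min 1 |G i (x i * y)|) (Set.Icc 1 2) := by
      refine cG.comp (by fun_prop : ContinuousOn (fun y => x i * y) (Set.Icc 1 2)) ?_
      intro y hy
      obtain ⟨hy1, hy2⟩ := hy
      constructor <;> nlinarith
    have iG' : IntervalIntegrable (fun y => min 1 |G i (x i * y)|) volume 1 2 :=
      (cG'.mono (by rw [Set.uIcc_of_le (by norm_num)])).intervalIntegrable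
    have iK : IntervalIntegrable (fun y => min 1 |K i y|) volume 1 2 :=
      (cK.mono (by rw [Set.uIcc_of_le (by norm_num)])).intervalIntegrable
    have iG : IntervalIntegrable (fun y => min 1 |G i y|) volume (1 / 2) 4 :=
      (cG.mono (by rw [Set.uIcc_of_le (by norm_num)])).intervalIntegrable
    have e1 : min 1 |d i| = ∫ y in (1 : ℝ)..2, min 1 |d i| := by simp; norm_num
    have e2 : ∫ y in (1 : ℝ)..2, min 1 |d i|
        ≤ ∫ y in (1 : ℝ)..2, (min 1 |G i (x i * y)| + min 1 |K i y|) := by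
      refine intervalIntegral.integral_mono_on (by norm_num) (by simp) (iG'.add iK) ?_
      intro y hy
      have := hd y hy
      have a1 := abs_nonneg (G i (x i * y))
      have a2 := abs_nonneg (K i y)
      rcases le_total 1 |G i (x i * y)| with h | h <;> rcases le_total 1 |K i y| with h' | h' <;>
        simp only [min_eq_left, min_eq_right, h, h'] <;>
        first
          | (exact (min_le_left _ _).trans (by linarith))
          | (exact (min_le_right _ _).trans (by linarith))
    rw [intervalIntegral.integral_add iG' iK,
      intervalIntegral.integral_comp_mul_left (fun y => min 1 |G i y|) hxp.ne'] at e2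
    have e3 : ∫ y in x i * 1..x i * 2, min 1 |G i y| ≤ ∫ y in (1 / 2 : ℝ)..4, min 1 |G i y| := by
      refine intervalIntegral.integral_mono_interval (by linarith) (by linarith) (by linarith) ?_ iG
      exact Eventually.of_forall fun y => le_min zero_le_one (abs_nonneg _)
    have e4 : (x i)⁻¹ ≤ 2 := by
      rw [inv_le_comm₀ hxp (by norm_num)]; linarith
    have e5 : 0 ≤ ∫ y in (1 / 2 : ℝ)..4, min 1 |G i y| :=
      intervalIntegral.integral_nonneg (by norm_num) fun y _ => le_min zero_le_one (abs_nonneg _)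
    have e6 : (x i)⁻¹ • ∫ y in x i * 1..x i * 2, min 1 |G i y|
        ≤ 2 * ∫ y in (1 / 2 : ℝ)..4, min 1 |G i y| := by
      rw [smul_eq_mul]
      exact (mul_le_mul_of_nonneg_left e3 (by positivity)).trans
        (mul_le_mul_of_nonneg_right e4 e5)
    linarith
  rw [tendsto_zero_iff_abs_tendsto_zero]
  refine h3.congr' ?_
  have : ∀ᶠ i in l, min 1 |d i| < 1 := h3.eventually_lt_const (by norm_num)
  filter_upwards [this] with i hi
  rcases min_lt_iff.1 hi with h | h
  · exact absurd h (lt_irrefl _)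
  · exact min_eq_right h.le

theorem tendsto_fst_mul_snd_atTop :
    Tendsto (fun z : ℝ × ℝ => z.1 * z.2) (atTop ×ˢ 𝓝 (1 : ℝ)) atTop :=
  tendsto_fst.atTop_mul_pos one_pos tendsto_snd

/-- Uniform convergence at `1` for a regularly varying function. -/
theorem tendsto_div_prod_of_regularlyVarying {g : ℝ → ℝ} {p T : ℝ} (hg : ∀ᶠ t in atTop, 0 < g t)
    (hc : ContinuousOn g (Set.Ioi T))
    (hrv : ∀ x : ℝ, 0 < x → Tendsto (fun t => g (t * x) / g t) atTop (𝓝 (x ^ p))) :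
    Tendsto (fun z : ℝ × ℝ => g (z.1 * z.2) / g z.1) (atTop ×ˢ 𝓝 1) (𝓝 1) := by
  obtain ⟨S, hS⟩ := (eventually_atTop.1 (hg.and (eventually_gt_atTop (max T 0))))
  have hST : T < S := lt_of_le_of_lt (le_max_left _ _) (hS S le_rfl).2
  have hS0 : 0 < S := lt_of_le_of_lt (le_max_right _ _) (hS S le_rfl).2
  have hpos : ∀ t, S ≤ t → 0 < g t := fun t ht => (hS t ht).1
  have hlog : ∀ x : ℝ, 0 < x →
      Tendsto (fun t => Real.log (g (t * x) / g t) - p * Real.log x) atTop (𝓝 0) := by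
    intro x hx
    have := ((hrv x hx).log (Real.rpow_pos_of_pos hx p).ne')
    rw [Real.log_rpow hx] at this
    simpa using this.sub_const (p * Real.log x)
  have hmul := tendsto_fst_mul_snd_atTop
  have hcont : ∀ t a b, 2 * S ≤ t → 1 / 2 ≤ a →
      ContinuousOn (fun y => Real.log (g (t * y) / g t) - p * Real.log y) (Set.Icc a b) := by
    intro t a b ht ha
    have hge : ∀ y ∈ Set.Icc a b, S ≤ t * y := fun y hy => by
      have := hy.1; nlinarith
    refine ContinuousOn.sub (ContinuousOn.log (ContinuousOn.div_const ?_ _) ?_)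
      (continuousOn_const.mul (ContinuousOn.log continuousOn_id ?_))
    · exact hc.comp (by fun_prop) fun y hy => lt_of_lt_of_le hST (hge y hy)
    · intro y hy
      exact (div_pos (hpos _ (hge y hy)) (hpos _ (by linarith))).ne'
    · intro y hy
      have := hy.1
      show y ≠ 0
      linarith
  -- write `log g(tx) - log g(t)` as the difference of two increments ending at `t * x * y`
  have hd : Tendsto (fun z : ℝ × ℝ => Real.log (g (z.1 * z.2) / g z.1)) (atTop ×ˢ 𝓝 1) (𝓝 0) := by
    refine tendsto_zero_of_translation_bound (x := fun z => z.2)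
      (G := fun z y => Real.log (g (z.1 * y) / g z.1) - p * Real.log y)
      (K := fun z y => p * Real.log z.2 - (Real.log (g (z.1 * z.2 * y) / g (z.1 * z.2)) - p * Real.log y))
      tendsto_snd ?_ ?_ ?_ ?_ ?_
    · intro y hy
      exact (hlog y (by linarith [hy.1])).comp tendsto_fst
    · filter_upwards [tendsto_fst.eventually (eventually_ge_atTop (2 * S))] with z hz
      exact hcont _ _ _ hz le_rfl
    · intro y hy
      have h1 := (hlog y (by linarith [hy.1])).comp hmul
      have h2 : Tendsto (fun z : ℝ × ℝ => p * Real.log z.2) (atTop ×ˢ 𝓝 1) (𝓝 0) := by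
        have := (tendsto_snd (f := (atTop : Filter ℝ)) (g := 𝓝 (1 : ℝ))).log one_ne_zero
        simpa using this.const_mul p
      simpa using h2.sub h1
    · filter_upwards [hmul.eventually (eventually_ge_atTop (2 * S))] with z hz
      exact continuousOn_const.sub (hcont _ _ _ hz (by norm_num))
    · filter_upwards [hmul.eventually (eventually_ge_atTop S),
        tendsto_fst.eventually (eventually_ge_atTop S),
        tendsto_snd.eventually (lt_mem_nhds (zero_lt_one (α := ℝ)))] with z h1 h2 h3 y hy
      have hy0 : 0 < y := by linarith [hy.1]
      have p1 := (hpos _ h1)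
      have p2 := hpos _ h2
      have h4 : S ≤ z.1 * z.2 * y := by nlinarith [hy.1]
      have p3 := hpos _ h4
      rw [← mul_assoc, Real.log_div p1.ne' p2.ne', Real.log_div p3.ne' p2.ne',
        Real.log_div p3.ne' p1.ne', Real.log_mul h3.ne' hy0.ne']
      refine le_trans (le_of_eq ?_) (abs_add_le _ _)
      congr 1; ring
  have := hd.rexp
  rw [Real.exp_zero] at this
  refine this.congr' ?_
  filter_upwards [hmul.eventually (eventually_ge_atTop S),
        tendsto_fst.eventually (eventually_ge_atTop S)] with z h1 h2
  exact Real.exp_log (div_pos (hpos _ h1) (hpos _ h2))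

/-- A function contracted by doubling of its argument tends to `0`. -/
theorem tendsto_zero_of_doubling {g : ℝ → ℝ} {T θ : ℝ} (hg : ∀ᶠ t in atTop, 0 ≤ g t)
    (hc : ContinuousOn g (Set.Ioi T)) (hθ0 : 0 ≤ θ) (hθ : θ < 1)
    (h2 : ∀ᶠ t in atTop, g (t * 2) ≤ θ * g t) : Tendsto g atTop (𝓝 0) := by
  obtain ⟨S, hS⟩ := eventually_atTop.1 ((hg.and h2).and (eventually_gt_atTop (max T 0)))
  have hST : T < S := lt_of_le_of_lt (le_max_left _ _) (hS S le_rfl).2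
  have hS0 : 0 < S := lt_of_le_of_lt (le_max_right _ _) (hS S le_rfl).2
  have hit : ∀ (n : ℕ) s, S ≤ s → g (s * 2 ^ n) ≤ θ ^ n * g s := by
    intro n
    induction n with
    | zero => intro s _; simp
    | succ n ih =>
      intro s hs
      have h1 : S ≤ s * 2 ^ n := by
        have : (1 : ℝ) ≤ 2 ^ n := one_le_pow₀ (by norm_num)
        nlinarith
      have := (hS _ h1).1.2
      calc g (s * 2 ^ (n + 1)) = g (s * 2 ^ n * 2) := by ring_nf
        _ ≤ θ * g (s * 2 ^ n) := this
        _ ≤ θ * (θ ^ n * g s) := mul_le_mul_of_nonneg_left (ih s hs) hθ0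
        _ = _ := by ring
  obtain ⟨M, hM⟩ := (isCompact_Icc (a := S) (b := 2 * S)).bddAbove_image
    (hc.mono fun y hy => lt_of_lt_of_le hST hy.1)
  have hM' : ∀ s ∈ Set.Icc S (2 * S), g s ≤ M := fun s hs => hM ⟨s, hs, rfl⟩
  have hM0 : 0 ≤ M := ((hS S le_rfl).1.1).trans (hM' S ⟨le_rfl, by linarith⟩)
  rw [Metric.tendsto_atTop]
  intro ε hε
  have hlim : Tendsto (fun n : ℕ => θ ^ n * M) atTop (𝓝 0) := by
    simpa using (tendsto_pow_atTop_nhds_zero_of_lt_one hθ0 hθ).mul_const M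
  obtain ⟨N, hN⟩ := eventually_atTop.1 (hlim.eventually_lt_const hε)
  refine ⟨S * 2 ^ N, fun t ht => ?_⟩
  have h2N : (1 : ℝ) ≤ 2 ^ N := one_le_pow₀ (by norm_num)
  have htS : S ≤ t := by nlinarith
  obtain ⟨n, hn1, hn2⟩ := exists_nat_pow_near (x := t / S) (y := 2) (by rw [le_div_iff₀ hS0]; linarith)
    (by norm_num)
  rw [le_div_iff₀ hS0] at hn1
  rw [div_lt_iff₀ hS0] at hn2
  have hnN : N ≤ n := by
    by_contra h
    have : (2 : ℝ) ^ (n + 1) ≤ 2 ^ N := pow_le_pow_right₀ (by norm_num) (by omega)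
    nlinarith
  have hpow : (0 : ℝ) < 2 ^ n := by positivity
  have hs : t / 2 ^ n ∈ Set.Icc S (2 * S) := by
    constructor
    · rw [le_div_iff₀ hpow]; linarith
    · rw [div_le_iff₀ hpow]; rw [pow_succ] at hn2; nlinarith
  have := hit n _ hs.1
  rw [div_mul_cancel₀ _ hpow.ne'] at this
  rw [Real.dist_eq, sub_zero, abs_of_nonneg (hS t htS).1.1]
  calc g t ≤ θ ^ n * g (t / 2 ^ n) := this
    _ ≤ θ ^ n * M := mul_le_mul_of_nonneg_left (hM' _ hs) (by positivity)
    _ < ε := hN n hnN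

/-! ### Second-order regular variation -/

theorem continuousAt_powQuot {r y : ℝ} (hr : r ≠ 0) (hy : 0 < y) : ContinuousAt (powQuot r) y := by
  have : powQuot r = fun x => (x ^ r - 1) / r := by
    funext x; simp [powQuot, hr]
  rw [this]
  exact ((Real.continuousAt_rpow_const y r (Or.inl hy.ne')).sub continuousAt_const).div_const _

theorem powQuot_mul {r x y : ℝ} (hr : r ≠ 0) (hx : 0 < x) (hy : 0 < y) :
    powQuot r (x * y) = x ^ r * powQuot r y + powQuot r x := by
  simp only [powQuot, hr, if_false]
  rw [Real.mul_rpow hx.le hy.le]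
  field_simp
  ring

theorem powQuot_two_pos {r : ℝ} (hr : r < 0) : 0 < powQuot r 2 := by
  simp only [powQuot, hr.ne, if_false]
  apply div_pos_of_neg_of_neg _ hr
  have := Real.rpow_lt_one_of_one_lt_of_neg (x := 2) (by norm_num) hr
  linarith

namespace IsSecondOrderRV

variable {χ A : ℝ → ℝ} {a r T : ℝ}

theorem aux_ne_zero (h : IsSecondOrderRV χ a r A) : ∀ᶠ t in atTop, A t ≠ 0 := by
  rcases h.aux_sign with h | h
  · filter_upwards [h] with t ht using ht.ne'
  · filter_upwards [h] with t ht using ht.ne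

theorem tendsto_ratio (h : IsSecondOrderRV χ a r A) {x : ℝ} (hx : 0 < x) :
    Tendsto (fun t => χ (t * x) / χ t) atTop (𝓝 (x ^ a)) := by
  have := ((h.tendsto x hx).mul h.aux_tendsto).add_const (x ^ a)
  simp only [mul_zero, zero_add] at this
  refine this.congr' ?_
  filter_upwards [h.aux_ne_zero] with t ht
  field_simp
  ring

/-- The increment of `χ` from `t` to `t * x * y` splits through the intermediate point `t * x`. -/
theorem cocycle (χ A : ℝ → ℝ) (a : ℝ) {t x y : ℝ} (h1 : χ t ≠ 0) (h2 : χ (t * x) ≠ 0)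
    (h3 : A t ≠ 0) (h4 : A (t * x) ≠ 0) (hx : 0 < x) (hy : 0 < y) :
    (χ (t * x * y) / χ t - (x * y) ^ a) / A t
      = (χ (t * x * y) / χ (t * x) - y ^ a) / A (t * x) * (A (t * x) / A t) * (χ (t * x) / χ t)
        + y ^ a * ((χ (t * x) / χ t - x ^ a) / A t) := by
  rw [Real.mul_rpow hx.le hy.le]
  field_simp
  ring

theorem tendsto_mul_const_atTop {x : ℝ} (hx : 0 < x) : Tendsto (fun t : ℝ => t * x) atTop atTop :=
  tendsto_id.atTop_mul_const hx

/-- The auxiliary function is itself regularly varying, with index `r`. -/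
theorem tendsto_aux_ratio (h : IsSecondOrderRV χ a r A) (hr : r < 0) {x : ℝ} (hx : 0 < x) :
    Tendsto (fun t => A (t * x) / A t) atTop (𝓝 (x ^ r)) := by
  have hmul := tendsto_mul_const_atTop hx
  have l1 := h.tendsto (x * 2) (by positivity)
  have l2 := (h.tendsto x hx).const_mul ((2 : ℝ) ^ a)
  have l3 := ((h.tendsto 2 (by norm_num)).comp hmul).mul (h.tendsto_ratio hx)
  have h2 := powQuot_two_pos hr
  have hxa : 0 < x ^ a := Real.rpow_pos_of_pos hx a
  have h2a : (0 : ℝ) < 2 ^ a := Real.rpow_pos_of_pos (by norm_num) a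
  have hne : (2 : ℝ) ^ a * powQuot r 2 * x ^ a ≠ 0 := by positivity
  have l4 := (l1.sub l2).div l3 hne
  have e : ((x * 2) ^ a * powQuot r (x * 2) - 2 ^ a * (x ^ a * powQuot r x))
      / (2 ^ a * powQuot r 2 * x ^ a) = x ^ r := by
    rw [powQuot_mul hr.ne hx (by norm_num), Real.mul_rpow hx.le (by norm_num)]
    field_simp
    ring
  rw [e] at l4
  refine l4.congr' ?_
  have l5 := l3.eventually_ne hne
  filter_upwards [h.aux_ne_zero, hmul.eventually h.aux_ne_zero, h.eventually_pos,
    hmul.eventually h.eventually_pos, l5] with t h1 h2 h3 h4 h5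
  have := cocycle χ A a h3.ne' h4.ne' h1 h2 hx (y := 2) (by norm_num)
  simp only [Function.comp_def, Pi.div_apply] at h5 ⊢
  rw [div_eq_iff h5, ← mul_assoc t x 2, this]
  ring

/-- If `χ` is continuous, the auxiliary function may be chosen continuous: the defining limit at
`x = 2` shows that it is equivalent to a multiple of `χ (2 t) / χ t - 2 ^ a`. The given auxiliary
function need not even be measurable, so this replacement is what makes integration over the
scaling variable possible. -/
theorem exists_continuous_aux (h : IsSecondOrderRV χ a r A) (hr : r < 0)
    (hc : ContinuousOn χ (Set.Ioi T)) :
    ∃ (B : ℝ → ℝ) (S : ℝ), IsSecondOrderRV χ a r B ∧ ContinuousOn B (Set.Ioi S) ∧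
      Tendsto (fun t => B t / A t) atTop (𝓝 1) := by
  obtain ⟨S, hS⟩ := eventually_atTop.1 (h.eventually_pos.and (eventually_gt_atTop (max T 0)))
  have hST : T < S := lt_of_le_of_lt (le_max_left _ _) (hS S le_rfl).2
  have hS0 : 0 < S := lt_of_le_of_lt (le_max_right _ _) (hS S le_rfl).2
  have h2 := powQuot_two_pos hr
  have h2a : (0 : ℝ) < 2 ^ a := Real.rpow_pos_of_pos (by norm_num) a
  set k : ℝ := 2 ^ a * powQuot r 2 with hk
  have hk0 : 0 < k := by positivity
  have hBA : Tendsto (fun t => (χ (t * 2) / χ t - 2 ^ a) / k / A t) atTop (𝓝 1) := by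
    have := (h.tendsto 2 (by norm_num)).div_const k
    rw [div_self hk0.ne'] at this
    refine this.congr fun t => ?_
    rw [div_right_comm]
  have hpos := hBA.eventually_const_lt zero_lt_one
  refine ⟨fun t => (χ (t * 2) / χ t - 2 ^ a) / k, S, ⟨h.measurable, h.eventually_pos,
    h.param_nonpos, ?_, ?_, ?_⟩, ?_, hBA⟩
  · rcases h.aux_sign with hs | hs
    · left
      filter_upwards [hs, hpos] with t h1 h2
      exact (div_pos_iff_of_pos_right h1).1 h2
    · right
      filter_upwards [hs, hpos] with t h1 h2
      by_contra hcon
      exact absurd h2 (not_lt.2 (div_nonpos_of_nonneg_of_nonpos (not_lt.1 hcon) h1.le))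
  · have := hBA.mul h.aux_tendsto
    rw [mul_zero] at this
    refine this.congr' ?_
    filter_upwards [h.aux_ne_zero] with t ht
    exact div_mul_cancel₀ _ ht
  · intro x hx
    have := (h.tendsto x hx).div hBA one_ne_zero
    rw [div_one] at this
    refine this.congr' ?_
    filter_upwards [h.aux_ne_zero] with t ht
    exact div_div_div_cancel_right₀ ht _ _
  · have c1 : ContinuousOn (fun t => χ (t * 2)) (Set.Ioi S) :=
      hc.comp (by fun_prop) fun t ht => by
        have : S < t := ht
        show T < t * 2
        linarith
    refine (ContinuousOn.sub (c1.div (hc.mono fun t ht => hST.trans ht) ?_)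
      continuousOn_const).div_const _
    intro t ht
    exact (hS t (le_of_lt ht)).1.ne'

theorem tendsto_aux_prod (h : IsSecondOrderRV χ a r A) (hr : r < 0)
    (hA : ContinuousOn A (Set.Ioi T)) :
    Tendsto (fun z : ℝ × ℝ => A (z.1 * z.2) / A z.1) (atTop ×ˢ 𝓝 1) (𝓝 1) := by
  rcases h.aux_sign with hs | hs
  · exact tendsto_div_prod_of_regularlyVarying hs hA fun x hx => h.tendsto_aux_ratio hr hx
  · have := tendsto_div_prod_of_regularlyVarying (g := fun t => -A t) (p := r)
      (by filter_upwards [hs] with t ht using neg_pos.2 ht) hA.neg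
      (fun x hx => by simpa only [neg_div_neg_eq] using h.tendsto_aux_ratio hr hx)
    simpa only [neg_div_neg_eq] using this

/-- Uniform convergence at `1` in the definition of second-order regular variation. -/
theorem tendsto_prod (h : IsSecondOrderRV χ a r A) (hr : r < 0)
    (hc : ContinuousOn χ (Set.Ioi T)) :
    Tendsto (fun z : ℝ × ℝ => (χ (z.1 * z.2) / χ z.1 - z.2 ^ a) / A z.1) (atTop ×ˢ 𝓝 1) (𝓝 0) := by
  obtain ⟨B, S', hB, hBc, hBA⟩ := h.exists_continuous_aux hr hc
  suffices H : Tendsto (fun z : ℝ × ℝ => (χ (z.1 * z.2) / χ z.1 - z.2 ^ a) / B z.1)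
      (atTop ×ˢ 𝓝 1) (𝓝 0) by
    have := H.mul (hBA.comp tendsto_fst)
    rw [zero_mul] at this
    refine this.congr' ?_
    filter_upwards [tendsto_fst.eventually hB.aux_ne_zero] with z hz
    simp only [Function.comp_def]
    field_simp
  have hmul := tendsto_fst_mul_snd_atTop
  obtain ⟨S, hS⟩ := eventually_atTop.1 ((hB.eventually_pos.and hB.aux_ne_zero).and
    (eventually_gt_atTop (max T 0)))
  have hST : T < S := lt_of_le_of_lt (le_max_left _ _) (hS S le_rfl).2
  have hS0 : 0 < S := lt_of_le_of_lt (le_max_right _ _) (hS S le_rfl).2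
  have hpos : ∀ t, S ≤ t → 0 < χ t := fun t ht => (hS t ht).1.1
  have hne : ∀ t, S ≤ t → B t ≠ 0 := fun t ht => (hS t ht).1.2
  set k : ℝ → ℝ := fun y => y ^ a * powQuot r y with hk
  have hkc : ∀ y, 0 < y → ContinuousAt k y := fun y hy =>
    (Real.continuousAt_rpow_const y a (Or.inl hy.ne')).mul (continuousAt_powQuot hr.ne hy)
  set ψ : ℝ → ℝ → ℝ := fun t x => (χ (t * x) / χ t - x ^ a) / B t with hψ
  have hψl : ∀ y, 0 < y → Tendsto (fun t => ψ t y) atTop (𝓝 (k y)) := fun y hy => hB.tendsto y hy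
  have hψc : ∀ t p q, 2 * S ≤ t → 1 / 2 ≤ p → ContinuousOn (ψ t) (Set.Icc p q) := by
    intro t p q ht hp
    refine ((ContinuousOn.div_const ?_ _).sub ?_).div_const _
    · refine hc.comp (by fun_prop) fun y hy => ?_
      have := hy.1
      show T < t * y
      nlinarith
    · intro y hy
      have := hy.1
      exact (Real.continuousAt_rpow_const y a (Or.inl (by linarith))).continuousWithinAt
  have hkco : ∀ p q, 1 / 2 ≤ p → ContinuousOn k (Set.Icc p q) := fun p q hp y hy =>
    (hkc y (by linarith [hy.1])).continuousWithinAt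
  set b : ℝ × ℝ → ℝ := fun z => B (z.1 * z.2) / B z.1 * (χ (z.1 * z.2) / χ z.1) with hb
  have hb1 : Tendsto b (atTop ×ˢ 𝓝 1) (𝓝 1) := by
    have := (hB.tendsto_aux_prod hr hBc).mul (tendsto_div_prod_of_regularlyVarying (p := a)
      h.eventually_pos hc fun x hx => h.tendsto_ratio hx)
    simpa using this
  set m : ℝ := min 1 (2 ^ a) with hm
  have hm0 : 0 < m := lt_min one_pos (Real.rpow_pos_of_pos (by norm_num) a)
  have hmy : ∀ y ∈ Set.Icc (1 : ℝ) 2, m ≤ y ^ a := by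
    intro y hy
    rcases le_total 0 a with ha | ha
    · exact (min_le_left _ _).trans (Real.one_le_rpow hy.1 ha)
    · exact (min_le_right _ _).trans
        (Real.rpow_le_rpow_of_nonpos (by linarith [hy.1]) hy.2 ha)
  -- the cocycle identity gives `y ^ a * ψ t x = ψ t (x * y) - b (t, x) * ψ (t * x) y`, and
  -- `y ^ a` is at least `m` on `[1, 2]`
  have key : Tendsto (fun z : ℝ × ℝ => m * ψ z.1 z.2) (atTop ×ˢ 𝓝 1) (𝓝 0) := by
    refine tendsto_zero_of_translation_bound (x := fun z => z.2)
      (G := fun z y => ψ z.1 y - k y)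
      (K := fun z y => k (z.2 * y) - b z * ψ (z.1 * z.2) y) tendsto_snd ?_ ?_ ?_ ?_ ?_
    · intro y hy
      simpa using (((hψl y (by linarith [hy.1])).comp tendsto_fst).sub_const (k y))
    · filter_upwards [tendsto_fst.eventually (eventually_ge_atTop (2 * S))] with z hz
      exact (hψc _ _ _ hz le_rfl).sub (hkco _ _ le_rfl)
    · intro y hy
      have hy0 : 0 < y := by linarith [hy.1]
      have l1 : Tendsto (fun z : ℝ × ℝ => k (z.2 * y)) (atTop ×ˢ 𝓝 1) (𝓝 (k y)) := by
        have : Tendsto (fun z : ℝ × ℝ => z.2 * y) (atTop ×ˢ 𝓝 1) (𝓝 y) := by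
          simpa using (tendsto_snd (f := (atTop : Filter ℝ)) (g := 𝓝 (1 : ℝ))).mul_const y
        exact (hkc y hy0).tendsto.comp this
      have l2 := hb1.mul ((hψl y hy0).comp hmul)
      simpa using l1.sub l2
    · filter_upwards [hmul.eventually (eventually_ge_atTop (2 * S)),
        tendsto_snd.eventually (lt_mem_nhds (show (1 / 2 : ℝ) < 1 by norm_num))] with z hz hz2
      refine ContinuousOn.sub ?_ (continuousOn_const.mul (hψc _ _ _ hz (by norm_num)))
      intro y hy
      have hpos : 0 < z.2 * y := mul_pos (by linarith) (by linarith [hy.1])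
      exact ((hkc _ hpos).comp (f := fun y => z.2 * y) (by fun_prop)).continuousWithinAt
    · filter_upwards [hmul.eventually (eventually_ge_atTop S),
        tendsto_fst.eventually (eventually_ge_atTop S),
        tendsto_snd.eventually (lt_mem_nhds (zero_lt_one (α := ℝ)))] with z h1 h2 h3 y hy
      have hy0 : 0 < y := by linarith [hy.1]
      have := cocycle χ B a (hpos _ h2).ne' (hpos _ h1).ne' (hne _ h2) (hne _ h1) h3 hy0
      have e : y ^ a * ψ z.1 z.2 = (ψ z.1 (z.2 * y) - k (z.2 * y))
          + (k (z.2 * y) - b z * ψ (z.1 * z.2) y) := by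
        simp only [hψ, hb, ← mul_assoc] at this ⊢
        rw [this]; ring
      calc |m * ψ z.1 z.2| ≤ |y ^ a * ψ z.1 z.2| := by
            rw [abs_mul, abs_mul, abs_of_pos hm0]
            exact mul_le_mul_of_nonneg_right ((hmy y hy).trans (le_abs_self _)) (abs_nonneg _)
        _ ≤ _ := by rw [e]; exact abs_add_le _ _
  have := key.const_mul m⁻¹
  simpa [inv_mul_cancel_left₀ hm0.ne'] using this

theorem tendsto_atTop_of_pos (h : IsSecondOrderRV χ a r A) (ha : 0 < a)
    (hc : ContinuousOn χ (Set.Ioi T)) : Tendsto χ atTop atTop := by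
  obtain ⟨S, hS⟩ := eventually_atTop.1 (h.eventually_pos.and (eventually_gt_atTop T))
  have h0 : Tendsto (fun t => (χ t)⁻¹) atTop (𝓝 0) := by
    have hlt : (1 : ℝ) < 2 ^ a := Real.one_lt_rpow (by norm_num) ha
    obtain ⟨c, hc1, hc2⟩ := exists_between hlt
    refine tendsto_zero_of_doubling (T := S) (θ := c⁻¹) ?_ ?_ (by positivity) (inv_lt_one_of_one_lt₀ hc1) ?_
    · filter_upwards [h.eventually_pos] with t ht
      positivity
    · exact (hc.mono fun t ht => (hS S le_rfl).2.trans ht).inv₀ fun t ht =>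
        (hS t (le_of_lt ht)).1.ne'
    · filter_upwards [h.eventually_pos, (tendsto_mul_const_atTop two_pos).eventually h.eventually_pos,
        (h.tendsto_ratio two_pos).eventually_const_lt hc2] with t h1 h2 h3
      rw [lt_div_iff₀ h1] at h3
      rw [← mul_inv]
      exact inv_anti₀ (by positivity) h3.le
  refine (tendsto_inv_nhdsGT_zero.comp (tendsto_nhdsWithin_iff.2 ⟨h0, ?_⟩)).congr fun t => inv_inv _
  filter_upwards [h.eventually_pos] with t ht
  exact inv_pos.2 ht

theorem tendsto_div_id (h : IsSecondOrderRV χ a r A) (ha : a < 1)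
    (hc : ContinuousOn χ (Set.Ioi T)) : Tendsto (fun t => χ t / t) atTop (𝓝 0) := by
  have hlt : (2 : ℝ) ^ a < 2 := by
    simpa using Real.rpow_lt_rpow_of_exponent_lt (x := 2) (by norm_num) ha
  obtain ⟨c, hc1, hc2⟩ := exists_between hlt
  have hc0 : 0 < c := (Real.rpow_pos_of_pos (by norm_num) a).trans hc1
  refine tendsto_zero_of_doubling (T := max T 0) (θ := c / 2) ?_ ?_ (by positivity) (by linarith) ?_
  · filter_upwards [h.eventually_pos, eventually_gt_atTop 0] with t ht h0
    positivity
  · refine (hc.mono (Set.Ioi_subset_Ioi (le_max_left _ _))).div continuousOn_id fun t ht => ?_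
    exact ((le_max_right T 0).trans_lt ht).ne'
  · filter_upwards [h.eventually_pos, (h.tendsto_ratio two_pos).eventually_lt_const hc1,
      eventually_gt_atTop 0] with t h1 h2 h3
    rw [div_lt_iff₀ h1] at h2
    rw [div_le_iff₀ (by positivity)]
    have : c / 2 * (χ t / t) * (t * 2) = c * χ t := by field_simp
    linarith

theorem tendsto_aux_mul (h : IsSecondOrderRV χ a r A) (hr : r < 0) (har : a + r < 0)
    (hc : ContinuousOn χ (Set.Ioi T)) : Tendsto (fun t => |A t| * χ t) atTop (𝓝 0) := by
  obtain ⟨B, S', hB, hBc, hBA⟩ := h.exists_continuous_aux hr hc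
  suffices H : Tendsto (fun t => |B t| * χ t) atTop (𝓝 0) by
    have := H.div hBA.abs (by simp)
    rw [zero_div] at this
    refine this.congr' ?_
    filter_upwards [hB.aux_ne_zero] with t ht
    simp only [Pi.div_apply]
    rw [abs_div]
    have : |B t| ≠ 0 := abs_ne_zero.2 ht
    field_simp
  have hlt : (2 : ℝ) ^ (a + r) < 1 := Real.rpow_lt_one_of_one_lt_of_neg (by norm_num) har
  obtain ⟨c, hc1, hc2⟩ := exists_between hlt
  have hc0 : 0 < c := (Real.rpow_pos_of_pos (by norm_num) _).trans hc1
  refine tendsto_zero_of_doubling (T := max T S') (θ := c) ?_ ?_ hc0.le hc2 ?_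
  · filter_upwards [h.eventually_pos] with t ht
    positivity
  · exact (hBc.mono (Set.Ioi_subset_Ioi (le_max_right _ _))).abs.mul
      (hc.mono (Set.Ioi_subset_Ioi (le_max_left _ _)))
  · have l := (hB.tendsto_aux_ratio hr two_pos).abs.mul (h.tendsto_ratio two_pos)
    rw [abs_of_pos (Real.rpow_pos_of_pos two_pos _), ← Real.rpow_add two_pos, add_comm r a] at l
    filter_upwards [h.eventually_pos, l.eventually_lt_const hc1, hB.aux_ne_zero] with t h1 h2 h3
    have h3' : 0 < |B t| := abs_pos.2 h3
    rw [abs_div, div_mul_div_comm, div_lt_iff₀ (by positivity)] at h2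
    exact h2.le

end IsSecondOrderRV

/-! ### Laplace asymptotics -/

theorem one_add_rpow_taylor_isBigO (r : ℝ) :
    (fun y : ℝ => (1 + y) ^ r - (1 + r * y + r * (r - 1) / 2 * y ^ 2
      + r * (r - 1) * (r - 2) / 6 * y ^ 3 + r * (r - 1) * (r - 2) * (r - 3) / 24 * y ^ 4))
      =O[𝓝 0] fun y => ‖y‖ ^ 5 := by
  have h := (Real.one_add_rpow_hasFPowerSeriesAt_zero (a := r)).isBigO_sub_partialSum_pow 5
  refine h.congr_left fun y => ?_
  simp only [FormalMultilinearSeries.partialSum, Finset.sum_range_succ, Finset.sum_range_zero,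
    binomialSeries, FormalMultilinearSeries.ofScalars_apply_eq, Ring.choose_eq_smul, zero_add,
    smul_eq_mul]
  have e2 : (Polynomial.aeval r) (2 : Polynomial ℤ) = 2 := map_ofNat _ 2
  have e3 : (Polynomial.aeval r) (3 : Polynomial ℤ) = 3 := map_ofNat _ 3
  simp [descPochhammer_succ_right, Nat.factorial, ← Polynomial.aeval_eq_smeval, e2, e3]
  ring

theorem two_sided_rpow_taylor_isBigO (r : ℝ) :
    (fun y : ℝ => (1 + y) ^ r + (1 - y) ^ r - 2 - (r * (r - 1) * y ^ 2
      + r * (r - 1) * (r - 2) * (r - 3) / 12 * y ^ 4)) =O[𝓝 0] fun y => ‖y‖ ^ 5 := by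
  have h1 := one_add_rpow_taylor_isBigO r
  have hneg : Tendsto (fun y : ℝ => -y) (𝓝 0) (𝓝 0) := by
    simpa using (continuous_neg (G := ℝ)).tendsto 0
  have h2 := h1.comp_tendsto hneg
  simp only [Function.comp_def, norm_neg] at h2
  refine (h1.add h2).congr_left fun y => ?_
  rw [← sub_eq_add_neg]
  ring

theorem two_sided_rpow_isBigO_sq (r : ℝ) :
    (fun y : ℝ => (1 + y) ^ r + (1 - y) ^ r - 2) =O[𝓝 0] fun y => y ^ 2 := by
  have h := (two_sided_rpow_taylor_isBigO r).trans
    (g := fun y : ℝ => ‖y‖ ^ 5) (k := fun y : ℝ => y ^ 2) ?_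
  · have h2 : (fun y : ℝ => r * (r - 1) * y ^ 2 + r * (r - 1) * (r - 2) * (r - 3) / 12 * y ^ 4)
        =O[𝓝 0] fun y : ℝ => y ^ 2 := by
      refine ((isBigO_refl _ _).const_mul_left _).add (IsBigO.const_mul_left ?_ _)
      exact (isLittleO_pow_pow (by norm_num)).isBigO
    exact (h.add h2).congr_left fun y => by ring
  · have : (fun y : ℝ => ‖y‖ ^ 5) = fun y : ℝ => ‖y ^ 5‖ := by funext y; rw [norm_pow]
    rw [this]
    exact ((isLittleO_pow_pow (𝕜 := ℝ) (m := 2) (n := 5) (by norm_num)).isBigO).norm_left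

theorem abs_exp_sub_exp_le (a b : ℝ) :
    |Real.exp a - Real.exp b| ≤ |a - b| * Real.exp (max a b) := by
  wlog h : b ≤ a generalizing a b
  · rw [abs_sub_comm, abs_sub_comm a, max_comm]
    exact this b a (le_of_not_ge h)
  rw [max_eq_left h, abs_of_nonneg (sub_nonneg.2 (Real.exp_le_exp.2 h)),
    abs_of_nonneg (sub_nonneg.2 h)]
  have h1 := Real.add_one_le_exp (b - a)
  have h2 : Real.exp b = Real.exp a * Real.exp (b - a) := by rw [← Real.exp_add]; ring_nf
  rw [h2]
  nlinarith [Real.exp_pos a]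

theorem integrable_pow_mul_exp_neg_mul_sq {b : ℝ} (hb : 0 < b) (n : ℕ) :
    Integrable fun x : ℝ => x ^ n * Real.exp (-b * x ^ 2) := by
  have h := integrable_rpow_mul_exp_neg_mul_sq hb (s := n) (by have : (0:ℝ) ≤ n := n.cast_nonneg
                                                               linarith)
  simpa using h

theorem integral_pow_four_mul_exp_neg_mul_sq {b : ℝ} (hb : 0 < b) :
    ∫ x in Set.Ioi (0 : ℝ), x ^ 4 * Real.exp (-b * x ^ 2)
      = 3 / 8 * √Real.pi * b ^ (-(5 / 2) : ℝ) := by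
  have h := integral_rpow_mul_exp_neg_mul_rpow (p := 2) (q := 4) (b := b) (by norm_num)
    (by norm_num) hb
  norm_num at h
  have hG : Real.Gamma (5 / 2) = 3 / 4 * √Real.pi := by
    rw [show (5 / 2 : ℝ) = (1 / 2 + 1) + 1 by norm_num, Real.Gamma_add_one (by norm_num),
      Real.Gamma_add_one (by norm_num), Real.Gamma_one_half_eq]
    ring
  rw [hG] at h
  simp only [neg_mul]
  rw [h]
  ring

theorem sqrt_mul_integral_comp {φ : ℝ → ℝ} {V : ℝ} (η : ℝ) :
    √V * ∫ y in (0 : ℝ)..η, φ (√V * y) = ∫ z in (0 : ℝ)..√V * η, φ z := by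
  have := intervalIntegral.mul_integral_comp_mul_left (f := φ) (a := 0) (b := η) (c := √V)
  simpa only [mul_zero] using this

theorem sqrt_mul_integral_comp_le {φ : ℝ → ℝ} {V η : ℝ} (hη : 0 ≤ η) (hV : 0 < V)
    (hφ : ∀ z, 0 ≤ φ z) (hi : Integrable φ) :
    √V * ∫ y in (0 : ℝ)..η, φ (√V * y) ≤ ∫ z in Set.Ioi (0 : ℝ), φ z := by
  rw [sqrt_mul_integral_comp η, intervalIntegral.integral_of_le (by positivity)]
  exact setIntegral_mono_set hi.integrableOn (Eventually.of_forall hφ)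
    (Set.Ioc_subset_Ioi_self.eventuallyLE)

theorem sqrt_mul_integral_gaussian_le {b V η : ℝ} (hb : 0 < b) (hη : 0 ≤ η) (hV : 0 < V) :
    √V * ∫ y in (0 : ℝ)..η, Real.exp (-b * V * y ^ 2) ≤ √(Real.pi / b) / 2 := by
  rw [← integral_gaussian_Ioi]
  refine le_trans (le_of_eq ?_) (sqrt_mul_integral_comp_le hη hV (fun z => (Real.exp_pos _).le)
    (integrable_exp_neg_mul_sq hb))
  congr 1
  refine intervalIntegral.integral_congr fun y _ => ?_
  rw [mul_pow, Real.sq_sqrt hV.le, mul_assoc]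

theorem sqrt_mul_integral_sq_gaussian_le {b : ℝ} (hb : 0 < b) :
    ∃ C, 0 < C ∧ ∀ V η : ℝ, 0 ≤ η → 0 < V →
      √V * ∫ y in (0 : ℝ)..η, y ^ 2 * Real.exp (-b * V * y ^ 2) ≤ C / V := by
  have h0 : 0 ≤ ∫ z in Set.Ioi (0 : ℝ), z ^ 2 * Real.exp (-b * z ^ 2) :=
    integral_nonneg fun z => by positivity
  refine ⟨(∫ z in Set.Ioi (0 : ℝ), z ^ 2 * Real.exp (-b * z ^ 2)) + 1, by linarith,
    fun V η hη hV => ?_⟩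
  have h := sqrt_mul_integral_comp_le (φ := fun z => z ^ 2 * Real.exp (-b * z ^ 2)) hη hV
    (fun z => by positivity) (integrable_pow_mul_exp_neg_mul_sq hb 2)
  rw [le_div_iff₀ hV]
  refine le_trans (le_of_eq ?_) (h.trans (le_add_of_nonneg_right zero_le_one))
  rw [mul_assoc, ← intervalIntegral.integral_mul_const]
  congr 1
  refine intervalIntegral.integral_congr fun y _ => ?_
  rw [mul_pow, Real.sq_sqrt hV.le, mul_assoc (-b) V]
  ring

/-- Two-term Laplace expansion at an endpoint where the exponent is even to fourth order. -/
theorem tendsto_laplace_second_order {q : ℝ → ℝ} {η c κ k K : ℝ} (hη : 0 < η) (hc : 0 < c)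
    (hcκ : c ≤ κ) (hK : 0 ≤ K) (hqc : ContinuousOn q (Set.Icc 0 η))
    (hq : ∀ y ∈ Set.Icc 0 η, q y ≤ -c * y ^ 2)
    (hq4 : ∀ y ∈ Set.Icc 0 η, |q y + κ * y ^ 2| ≤ K * y ^ 4)
    (hlim : Tendsto (fun y => (q y + κ * y ^ 2) / y ^ 4) (𝓝[>] 0) (𝓝 (-k))) :
    Tendsto (fun V => V * (√V * (∫ y in (0 : ℝ)..η, Real.exp (V * q y)) - √(Real.pi / κ) / 2))
      atTop (𝓝 (-k * (3 / 8 * √Real.pi * κ ^ (-(5 / 2) : ℝ)))) := by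
  have hκ : 0 < κ := hc.trans_le hcκ
  set F : ℝ → ℝ → ℝ := fun V z => V * ((Set.Ioc 0 (√V * η)).indicator
    (fun z => Real.exp (V * q (z / √V))) z - Real.exp (-κ * z ^ 2)) with hF
  have hint : ∀ V, 0 < V → ContinuousOn (fun z => Real.exp (V * q (z / √V)))
      (Set.Icc 0 (√V * η)) := by
    intro V hV
    have hs : 0 < √V := Real.sqrt_pos.2 hV
    refine (continuousOn_const.mul (hqc.comp (by fun_prop) fun z hz => ?_)).rexp
    refine ⟨div_nonneg hz.1 hs.le, ?_⟩
    rw [div_le_iff₀ hs, mul_comm]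
    exact hz.2
  have h1 : ∀ V, 0 < V → V * (√V * (∫ y in (0 : ℝ)..η, Real.exp (V * q y)) - √(Real.pi / κ) / 2)
      = ∫ z in Set.Ioi (0 : ℝ), F V z := by
    intro V hV
    have hs : 0 < √V := Real.sqrt_pos.2 hV
    have e1 : √V * (∫ y in (0 : ℝ)..η, Real.exp (V * q y))
        = ∫ z in Set.Ioi (0 : ℝ), (Set.Ioc 0 (√V * η)).indicator
          (fun z => Real.exp (V * q (z / √V))) z := by
      rw [setIntegral_indicator measurableSet_Ioc,
        Set.inter_eq_self_of_subset_right Set.Ioc_subset_Ioi_self,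
        ← intervalIntegral.integral_of_le (by positivity), ← sqrt_mul_integral_comp η]
      congr 1
      refine intervalIntegral.integral_congr fun y _ => ?_
      rw [mul_div_cancel_left₀ _ hs.ne']
    have i1 : Integrable ((Set.Ioc 0 (√V * η)).indicator
        (fun z => Real.exp (V * q (z / √V)))) (volume.restrict (Set.Ioi 0)) := by
      refine Integrable.restrict ?_
      rw [integrable_indicator_iff measurableSet_Ioc]
      exact ((hint V hV).integrableOn_Icc).mono_set Set.Ioc_subset_Icc_self
    rw [hF, e1, ← integral_gaussian_Ioi, ← integral_sub i1
      (integrable_exp_neg_mul_sq hκ).integrableOn, ← integral_const_mul]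
  have h2 : -k * (3 / 8 * √Real.pi * κ ^ (-(5 / 2) : ℝ))
      = ∫ z in Set.Ioi (0 : ℝ), -k * (z ^ 4 * Real.exp (-κ * z ^ 2)) := by
    rw [integral_const_mul, integral_pow_four_mul_exp_neg_mul_sq hκ]
  rw [h2]
  refine Tendsto.congr' (f₁ := fun V => ∫ z in Set.Ioi (0 : ℝ), F V z) ?_ ?_
  · filter_upwards [eventually_gt_atTop 0] with V hV using (h1 V hV).symm
  refine tendsto_integral_filter_of_dominated_convergence
    (fun z => K * (z ^ 4 * Real.exp (-c * z ^ 2)) + (η ^ 2)⁻¹ * (z ^ 2 * Real.exp (-κ * z ^ 2)))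
    ?_ ?_ ?_ ?_
  · filter_upwards [eventually_gt_atTop 0] with V hV
    refine AEStronglyMeasurable.const_mul (AEStronglyMeasurable.sub ?_ ?_) V
    · refine (aestronglyMeasurable_indicator_iff measurableSet_Ioc).2 ?_
      rw [Measure.restrict_restrict measurableSet_Ioc]
      exact ((hint V hV).mono (Set.inter_subset_left.trans
        Set.Ioc_subset_Icc_self)).aestronglyMeasurable (measurableSet_Ioc.inter measurableSet_Ioi)
    · exact (by fun_prop : Continuous fun z : ℝ => Real.exp (-κ * z ^ 2)).aestronglyMeasurable
  · filter_upwards [eventually_gt_atTop 0] with V hV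
    have hs : 0 < √V := Real.sqrt_pos.2 hV
    filter_upwards [ae_restrict_mem measurableSet_Ioi] with z hz
    have hz0 : 0 < z := hz
    have hκz : 0 ≤ (η ^ 2)⁻¹ * (z ^ 2 * Real.exp (-κ * z ^ 2)) := by positivity
    have hcz : 0 ≤ K * (z ^ 4 * Real.exp (-c * z ^ 2)) := by positivity
    by_cases hzm : z ∈ Set.Ioc 0 (√V * η)
    · simp only [hF, Set.indicator_of_mem hzm]
      set y := z / √V with hy
      have hym : y ∈ Set.Icc 0 η :=
        ⟨by positivity, by rw [hy, div_le_iff₀ hs, mul_comm]; exact hzm.2⟩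
      have hzy : z ^ 2 = V * y ^ 2 := by
        rw [hy, div_pow, Real.sq_sqrt hV.le]; field_simp
      have hzy4 : z ^ 4 = V ^ 2 * y ^ 4 := by
        calc z ^ 4 = (z ^ 2) ^ 2 := by ring
          _ = _ := by rw [hzy]; ring
      have hb := abs_exp_sub_exp_le (V * q y) (-κ * z ^ 2)
      have hmax : max (V * q y) (-κ * z ^ 2) ≤ -c * z ^ 2 := by
        refine max_le ?_ ?_
        · rw [hzy]
          have := mul_le_mul_of_nonneg_left (hq y hym) hV.le
          linarith
        · nlinarith [sq_nonneg z]
      have hab : |V * q y - -κ * z ^ 2| ≤ V * (K * y ^ 4) := by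
        rw [hzy, show V * q y - -κ * (V * y ^ 2) = V * (q y + κ * y ^ 2) by ring, abs_mul,
          abs_of_pos hV]
        exact mul_le_mul_of_nonneg_left (hq4 y hym) hV.le
      rw [norm_mul, Real.norm_of_nonneg hV.le, Real.norm_eq_abs]
      calc V * |Real.exp (V * q y) - Real.exp (-κ * z ^ 2)|
          ≤ V * (V * (K * y ^ 4) * Real.exp (-c * z ^ 2)) := by
            refine mul_le_mul_of_nonneg_left (hb.trans ?_) hV.le
            exact mul_le_mul hab (Real.exp_le_exp.2 hmax) (Real.exp_pos _).le (by positivity)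
        _ = K * (z ^ 4 * Real.exp (-c * z ^ 2)) := by rw [hzy4]; ring
        _ ≤ _ := by linarith
    · simp only [hF, Set.indicator_of_notMem hzm, zero_sub, norm_mul, norm_neg]
      rw [Real.norm_of_nonneg hV.le, Real.norm_of_nonneg (Real.exp_pos _).le]
      have hlt : √V * η < z := by
        by_contra h
        exact hzm ⟨hz0, not_lt.1 h⟩
      have : V ≤ (η ^ 2)⁻¹ * z ^ 2 := by
        rw [inv_mul_eq_div, le_div_iff₀ (by positivity)]
        calc V * η ^ 2 = (√V * η) ^ 2 := by rw [mul_pow, Real.sq_sqrt hV.le]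
          _ ≤ z ^ 2 := pow_le_pow_left₀ (by positivity) hlt.le 2
      calc V * Real.exp (-κ * z ^ 2) ≤ (η ^ 2)⁻¹ * z ^ 2 * Real.exp (-κ * z ^ 2) :=
            mul_le_mul_of_nonneg_right this (Real.exp_pos _).le
        _ ≤ _ := by linarith
  · exact (((integrable_pow_mul_exp_neg_mul_sq hc 4).const_mul K).add
      ((integrable_pow_mul_exp_neg_mul_sq hκ 2).const_mul _)).integrableOn
  · filter_upwards [ae_restrict_mem measurableSet_Ioi] with z hz
    have hz0 : 0 < z := hz
    have hy : Tendsto (fun V : ℝ => z / √V) atTop (𝓝[>] 0) := by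
      refine tendsto_nhdsWithin_iff.2 ⟨Real.tendsto_sqrt_atTop.const_div_atTop z, ?_⟩
      filter_upwards [eventually_gt_atTop 0] with V hV
      exact div_pos hz0 (Real.sqrt_pos.2 hV)
    set X : ℝ → ℝ := fun V => V * q (z / √V) + κ * z ^ 2 with hX
    have l1 : Tendsto (fun V => V * X V) atTop (𝓝 (z ^ 4 * -k)) := by
      refine ((hlim.comp hy).const_mul (z ^ 4)).congr' ?_
      filter_upwards [eventually_gt_atTop 0] with V hV
      have hs : 0 < √V := Real.sqrt_pos.2 hV
      have h4 : √V ^ 4 = V ^ 2 := by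
        calc √V ^ 4 = (√V ^ 2) ^ 2 := by ring
          _ = _ := by rw [Real.sq_sqrt hV.le]
      simp only [Function.comp_def, hX, div_pow, h4, Real.sq_sqrt hV.le]
      field_simp
    have l2 : Tendsto X atTop (𝓝 0) := by
      have := l1.mul tendsto_inv_atTop_zero
      rw [mul_zero] at this
      refine this.congr' ?_
      filter_upwards [eventually_gt_atTop 0] with V hV
      field_simp
    have l3 : Tendsto (fun V => V * (Real.exp (X V) - 1 - X V)) atTop (𝓝 0) := by
      have h0 := (l1.mul l2).abs
      rw [mul_zero, abs_zero] at h0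
      refine squeeze_zero_norm' ?_ h0
      have hsmall : ∀ᶠ V in atTop, |X V| < 1 := by
        have := l2.abs
        rw [abs_zero] at this
        exact this.eventually_lt_const one_pos
      filter_upwards [hsmall] with V hV
      rw [Real.norm_eq_abs, abs_mul, mul_assoc, abs_mul V]
      refine mul_le_mul_of_nonneg_left ?_ (abs_nonneg _)
      rw [← sq, abs_of_nonneg (sq_nonneg (X V))]
      exact Real.abs_exp_sub_one_sub_id_le hV.le
    have l4 := (l1.add l3).mul_const (Real.exp (-κ * z ^ 2))
    rw [add_zero] at l4
    have e : -k * (z ^ 4 * Real.exp (-κ * z ^ 2)) = z ^ 4 * -k * Real.exp (-κ * z ^ 2) := by ring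
    rw [e]
    refine l4.congr' ?_
    have hmem : ∀ᶠ V : ℝ in atTop, z ≤ √V * η :=
      (Real.tendsto_sqrt_atTop.atTop_mul_const hη).eventually_ge_atTop z
    filter_upwards [hmem] with V hV
    simp only [hF, Set.indicator_of_mem (show z ∈ Set.Ioc 0 (√V * η) from ⟨hz0, hV⟩)]
    have : Real.exp (V * q (z / √V)) = Real.exp (X V) * Real.exp (-κ * z ^ 2) := by
      rw [← Real.exp_add]
      congr 1
      simp only [hX]; ring
    rw [this]
    ring

/-! ### The tail of the convolution square -/

theorem antitone_distTail (μ : Measure ℝ) [IsFiniteMeasure μ] : Antitone (distTail μ) :=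
  fun _ _ hab => measureReal_mono (Set.Ioi_subset_Ioi hab)

theorem distTail_nonneg (μ : Measure ℝ) (t : ℝ) : 0 ≤ distTail μ t := measureReal_nonneg

/-- Split `X + Y > 2 u` according to whether both, only the second, or only the first summand
exceeds `u`. -/
theorem distTail_conv_self_eq (μ : Measure ℝ) [IsProbabilityMeasure μ] (u : ℝ) :
    distTail (Measure.conv μ μ) (2 * u)
      = distTail μ u ^ 2 + 2 * ∫ x in Set.Iic u, distTail μ (2 * u - x) ∂μ := by
  set S : Set (ℝ × ℝ) := {p | p.1 ≤ u ∧ 2 * u < p.1 + p.2} with hS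
  have hSm : MeasurableSet S :=
    (measurableSet_le measurable_fst measurable_const).inter
      (measurableSet_lt measurable_const (measurable_fst.add measurable_snd))
  have hconv : distTail (Measure.conv μ μ) (2 * u)
      = (μ.prod μ).real ((Set.Ioi u ×ˢ Set.Ioi u) ∪ (S ∪ Prod.swap ⁻¹' S)) := by
    rw [distTail, Measure.conv, measureReal_def, measureReal_def,
      Measure.map_apply (by fun_prop) measurableSet_Ioi]
    congr 2
    ext ⟨x, y⟩
    simp only [hS, Set.mem_preimage, Set.mem_Ioi, Set.mem_union, Set.mem_prod, Set.mem_ofPred_eq,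
      Prod.swap_prod_mk]
    constructor
    · intro h
      rcases le_or_gt x u with hx | hx
      · exact Or.inr (Or.inl ⟨hx, h⟩)
      · rcases le_or_gt y u with hy | hy
        · exact Or.inr (Or.inr ⟨hy, by linarith⟩)
        · exact Or.inl ⟨hx, hy⟩
    · rintro (⟨h1, h2⟩ | ⟨h1, h2⟩ | ⟨h1, h2⟩) <;> linarith
  have hswap : (μ.prod μ).real (Prod.swap ⁻¹' S) = (μ.prod μ).real S := by
    rw [measureReal_def, measureReal_def, ← Measure.map_apply measurable_swap hSm,
      Measure.prod_swap]
  have hSval : (μ.prod μ).real S = ∫ x in Set.Iic u, distTail μ (2 * u - x) ∂μ := by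
    have hmeas : Measurable fun x => μ (Set.Ioi (2 * u - x)) := by
      apply Monotone.measurable
      intro a b hab
      exact measure_mono (Set.Ioi_subset_Ioi (by linarith))
    simp only [distTail, measureReal_def]
    rw [integral_toReal hmeas.aemeasurable (Eventually.of_forall fun x => measure_lt_top _ _),
      Measure.prod_apply hSm, ← lintegral_indicator measurableSet_Iic]
    congr 1
    refine lintegral_congr fun x => ?_
    by_cases hx : x ≤ u
    · rw [Set.indicator_of_mem (show x ∈ Set.Iic u from hx)]
      congr 1
      ext y
      simp only [hS, Set.mem_preimage, Set.mem_ofPred_eq, Set.mem_Ioi]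
      exact ⟨fun h => by linarith [h.2], fun h => ⟨hx, by linarith⟩⟩
    · rw [Set.indicator_of_notMem (show x ∉ Set.Iic u from hx)]
      convert measure_empty (μ := μ) using 2
      ext y
      simp [hS, hx]
  rw [hconv, measureReal_union, measureReal_union, hswap, hSval]
  · rw [measureReal_prod_prod, distTail]
    ring
  · rw [Set.disjoint_left]
    rintro ⟨x, y⟩ ⟨h1, h2⟩ ⟨h3, h4⟩
    simp only [Prod.swap_prod_mk] at *
    linarith
  · exact measurable_swap hSm
  · rw [Set.disjoint_left]
    rintro ⟨x, y⟩ ⟨h1, h2⟩ (⟨h3, h4⟩ | ⟨h3, h4⟩)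
    · exact absurd h1 (not_lt.2 h3)
    · exact absurd h2 (not_lt.2 h3)
  · exact hSm.union (measurable_swap hSm)

/-- Layer-cake form of integration by parts against a distribution on `(T, u]`. -/
theorem integral_primitive_eq (μ : Measure ℝ) [IsProbabilityMeasure μ] {T u : ℝ} (hTu : T ≤ u)
    {g : ℝ → ℝ} (hg0 : ∀ s ∈ Set.Icc 0 (u - T), 0 ≤ g s)
    (hgi : IntervalIntegrable g volume 0 (u - T)) :
    ∫ x in Set.Iic u, (∫ s in (0 : ℝ)..max 0 (x - T), g s) ∂μ
      = ∫ s in (0 : ℝ)..u - T, g s * (distTail μ (T + s) - distTail μ u) := by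
  have hL : 0 ≤ u - T := sub_nonneg.2 hTu
  set L := u - T with hLdef
  set g₁ : ℝ → ℝ := (Set.Ioc 0 L).indicator g with hg₁
  have hg₁0 : ∀ s, 0 ≤ g₁ s := fun s =>
    Set.indicator_nonneg (fun s hs => hg0 s (Set.Ioc_subset_Icc_self hs)) s
  have hg₁i : Integrable g₁ := by
    rw [hg₁, integrable_indicator_iff measurableSet_Ioc]
    exact (intervalIntegrable_iff_integrableOn_Ioc_of_le hL).1 hgi
  have hsame : ∀ x ∈ Set.Iic u, ∫ s in (0 : ℝ)..max 0 (x - T), g s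
      = ∫ s in (0 : ℝ)..max 0 (x - T), g₁ s := by
    intro x hx
    refine intervalIntegral.integral_congr_ae ?_
    filter_upwards with s hs
    rw [Set.uIoc_of_le (le_max_left _ _)] at hs
    have : max 0 (x - T) ≤ L := max_le hL (by have : x ≤ u := hx
                                              linarith)
    have hs' : s ∈ Set.Ioc 0 L := ⟨hs.1, hs.2.trans this⟩
    rw [hg₁, Set.indicator_of_mem hs']
  have hcont : Continuous fun b => ∫ s in (0 : ℝ)..b, g₁ s :=
    intervalIntegral.continuous_primitive (fun a b => hg₁i.intervalIntegrable) 0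
  have hlc := lintegral_comp_eq_lintegral_meas_lt_mul (μ.restrict (Set.Iic u))
    (f := fun x => max 0 (x - T)) (g := g₁) (Eventually.of_forall fun x => le_max_left _ _)
    (by fun_prop) (fun t _ => hg₁i.intervalIntegrable)
    (Eventually.of_forall hg₁0)
  rw [setIntegral_congr_fun measurableSet_Iic hsame, integral_eq_lintegral_of_nonneg_ae, hlc,
    intervalIntegral.integral_of_le hL, integral_eq_lintegral_of_nonneg_ae]
  · congr 1
    rw [← lintegral_indicator measurableSet_Ioc, ← lintegral_indicator measurableSet_Ioi]
    refine lintegral_congr fun s => ?_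
    by_cases hs : s ∈ Set.Ioc 0 L
    · rw [Set.indicator_of_mem (show s ∈ Set.Ioi 0 from hs.1), Set.indicator_of_mem hs, hg₁,
        Set.indicator_of_mem hs, mul_comm, ENNReal.ofReal_mul (hg0 s (Set.Ioc_subset_Icc_self hs))]
      congr 1
      have hset : {a : ℝ | s < max 0 (a - T)} ∩ Set.Iic u = Set.Ioi (T + s) \ Set.Ioi u := by
        ext a
        simp only [Set.mem_inter_iff, Set.mem_ofPred_eq, Set.mem_Iic, Set.mem_sdiff, Set.mem_Ioi,
          not_lt, lt_max_iff]
        constructor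
        · rintro ⟨h | h, h'⟩
          · exact absurd hs.1 (not_lt.2 h.le)
          · exact ⟨by linarith, h'⟩
        · rintro ⟨h, h'⟩
          exact ⟨Or.inr (by linarith), h'⟩
      rw [Measure.restrict_apply (measurableSet_lt measurable_const (by fun_prop)), hset,
        distTail, distTail,
        ← measureReal_sdiff (Set.Ioi_subset_Ioi (by linarith [hs.2])) measurableSet_Ioi,
        ofReal_measureReal]
    · have hg₁s : g₁ s = 0 := Set.indicator_of_notMem hs _
      rw [Set.indicator_of_notMem hs]
      by_cases hs' : s ∈ Set.Ioi (0 : ℝ)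
      · rw [Set.indicator_of_mem hs', hg₁s]; simp
      · rw [Set.indicator_of_notMem hs']
  · filter_upwards [ae_restrict_mem measurableSet_Ioc] with s hs
    exact mul_nonneg (hg0 s (Set.Ioc_subset_Icc_self hs))
      (sub_nonneg.2 (antitone_distTail μ (by linarith [hs.2])))
  · refine AEStronglyMeasurable.mul hgi.1.1 (Measurable.aestronglyMeasurable ?_)
    refine Measurable.sub_const ?_ _
    exact (antitone_distTail μ).measurable.comp (by fun_prop)
  · filter_upwards with x
    exact intervalIntegral.integral_nonneg (le_max_left _ _) fun s _ => hg₁0 s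
  · exact (hcont.comp (by fun_prop)).aestronglyMeasurable

/-- If the distribution has a density `f` beyond `T`, the convolution tail at `2 * u` is given by
an integral over a symmetric neighbourhood of `u`, up to a tail at `2 * u - T`. -/
theorem abs_distTail_conv_self_sub_le (μ : Measure ℝ) [IsProbabilityMeasure μ] {T u : ℝ}
    (hTu : T ≤ u) {f : ℝ → ℝ}
    (hd : ∀ x ∈ Set.Icc u (2 * u - T), HasDerivAt (distTail μ) (-f x) x)
    (hf : ∀ x ∈ Set.Icc u (2 * u - T), 0 ≤ f x)
    (hfi : IntervalIntegrable f volume u (2 * u - T)) :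
    |distTail (Measure.conv μ μ) (2 * u)
        - (2 * (∫ s in (0 : ℝ)..u - T, f (u + s) * distTail μ (u - s)) - distTail μ u ^ 2)|
      ≤ 2 * distTail μ (2 * u - T) := by
  set P := distTail μ with hP
  set L := u - T with hL
  have hL0 : 0 ≤ L := sub_nonneg.2 hTu
  set c : ℝ → ℝ := fun s => f (2 * u - T - s) with hc
  have hmem : ∀ s ∈ Set.Icc 0 L, 2 * u - T - s ∈ Set.Icc u (2 * u - T) := fun s hs =>
    ⟨by linarith [hs.2], by linarith [hs.1]⟩
  have hci : IntervalIntegrable c volume 0 L := by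
    have := (hfi.comp_sub_left (2 * u - T)).symm
    rw [show 2 * u - T - (2 * u - T) = 0 by ring, show 2 * u - T - u = L by rw [hL]; ring] at this
    exact this
  have hcP : ∀ v ∈ Set.Icc 0 L, ∫ s in (0 : ℝ)..v, c s = P (2 * u - T - v) - P (2 * u - T) := by
    intro v hv
    have hsub : Set.uIcc 0 v ⊆ Set.Icc 0 L := by
      rw [Set.uIcc_of_le hv.1]; exact Set.Icc_subset_Icc_right hv.2
    rw [intervalIntegral.integral_eq_sub_of_hasDerivAt (f := fun s => P (2 * u - T - s)) ?_ ?_]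
    · simp
    · intro s hs
      have h1 := hd _ (hmem s (hsub hs))
      have h2 : HasDerivAt (fun s => 2 * u - T - s) (-1) s := by
        simpa using (hasDerivAt_id s).const_sub (2 * u - T)
      have := h1.comp s h2
      simpa [Function.comp_def] using this
    · refine hci.mono_set ?_
      rw [Set.uIcc_of_le hL0]
      exact hsub
  have hpe := integral_primitive_eq μ hTu (g := c) (fun s hs => hf _ (hmem s hs)) hci
  have hPa : Antitone P := antitone_distTail μ
  have hP0 : ∀ x, 0 ≤ P x := distTail_nonneg μ
  have hP1 : ∀ x, P x ≤ 1 := fun x => measureReal_le_one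
  have hmeasP : ∀ h : ℝ → ℝ, Measurable h → Integrable (fun x => P (h x)) (μ.restrict (Set.Iic u)) := by
    intro h hh
    refine Integrable.of_bound (hPa.measurable.comp hh).aestronglyMeasurable 1 ?_
    filter_upwards with x
    rw [Real.norm_of_nonneg (hP0 _)]
    exact hP1 _
  -- replace the integrand by one which is constant to the left of `T`
  have e1 : ∫ x in Set.Iic u, (∫ s in (0 : ℝ)..max 0 (x - T), c s) ∂μ
      = ∫ x in Set.Iic u, P (2 * u - T - max 0 (x - T)) ∂μ - P (2 * u - T) * (1 - P u) := by
    have hIic : μ.real (Set.Iic u) = 1 - P u := by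
      rw [hP, distTail, ← probReal_compl_eq_one_sub measurableSet_Ioi, Set.compl_Ioi]
    rw [setIntegral_congr_fun measurableSet_Iic (g := fun x => P (2 * u - T - max 0 (x - T))
      - P (2 * u - T)) (fun x hx => hcP _ ⟨le_max_left _ _, max_le hL0 (by
        have : x ≤ u := hx
        linarith)⟩), integral_sub (hmeasP _ (by fun_prop)) (integrable_const _)]
    simp only [integral_const, smul_eq_mul, measureReal_restrict_apply_univ, hIic]
    ring
  have e2 : ∫ s in (0 : ℝ)..L, c s * (P (T + s) - P u)
      = (∫ s in (0 : ℝ)..L, f (u + s) * P (u - s)) - P u * (P u - P (2 * u - T)) := by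
    have hi : IntervalIntegrable (fun s => c s * P (T + s)) volume 0 L := by
      have hPc : IntervalIntegrable (fun s => P (T + s)) volume 0 L := by
        apply AntitoneOn.intervalIntegrable
        intro a _ b _ hab
        exact hPa (by linarith)
      have hb : ∀ᵐ s ∂volume.restrict (Set.uIoc 0 L), ‖P (T + s)‖ ≤ 1 := by
        filter_upwards with s
        rw [Real.norm_of_nonneg (hP0 _)]
        exact hP1 _
      rw [intervalIntegrable_iff] at hci hPc ⊢
      exact hci.mul_bdd hPc.aestronglyMeasurable hb
    have hsub : ∫ s in (0 : ℝ)..L, f (u + s) * P (u - s) = ∫ s in (0 : ℝ)..L, c s * P (T + s) := by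
      have := intervalIntegral.integral_comp_sub_left (a := 0) (b := L)
        (fun s => c s * P (T + s)) L
      simp only [sub_zero, sub_self] at this
      rw [← this]
      refine intervalIntegral.integral_congr fun s _ => ?_
      simp only [hc, hL]
      ring_nf
    simp only [mul_sub]
    rw [intervalIntegral.integral_sub hi (hci.mul_const _), hsub,
      intervalIntegral.integral_mul_const, hcP L ⟨hL0, le_rfl⟩,
      show 2 * u - T - L = u by rw [hL]; ring]
    ring
  -- the replacement costs at most `P (2 * u - T)`
  have e3 : ∫ x in Set.Iic u, P (2 * u - x) ∂μ ≤ ∫ x in Set.Iic u, P (2 * u - T - max 0 (x - T)) ∂μ := by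
    refine integral_mono (hmeasP _ (by fun_prop)) (hmeasP _ (by fun_prop)) fun x => hPa ?_
    rcases le_total 0 (x - T) with h | h
    · rw [max_eq_right h]; linarith
    · rw [max_eq_left h]; linarith
  have e4 : ∫ x in Set.Iic u, P (2 * u - T - max 0 (x - T)) ∂μ - P (2 * u - T)
      ≤ ∫ x in Set.Iic u, P (2 * u - x) ∂μ := by
    have h1 : ∫ x in Set.Iic u, (P (2 * u - T - max 0 (x - T)) - P (2 * u - T)) ∂μ
        ≤ ∫ x in Set.Iic u, P (2 * u - x) ∂μ := by
      refine integral_mono ((hmeasP _ (by fun_prop)).sub (integrable_const _))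
        (hmeasP _ (by fun_prop)) fun x => ?_
      simp only
      rcases le_total 0 (x - T) with h | h
      · rw [max_eq_right h, show 2 * u - T - (x - T) = 2 * u - x by ring]
        linarith [hP0 (2 * u - T)]
      · rw [max_eq_left h]; simp [hP0]
    rw [integral_sub (hmeasP _ (by fun_prop)) (integrable_const _)] at h1
    simp only [integral_const, smul_eq_mul, measureReal_restrict_apply_univ] at h1
    have : μ.real (Set.Iic u) * P (2 * u - T) ≤ 1 * P (2 * u - T) :=
      mul_le_mul_of_nonneg_right measureReal_le_one (hP0 _)
    linarith
  rw [distTail_conv_self_eq μ u, abs_le]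
  rw [e1, e2] at hpe
  constructor <;> nlinarith [hP0 (2 * u - T)]

/-! ### The symmetric second difference of the exponent -/

/-- The symmetric second difference `χ (u + s) + χ (u - s) - 2 χ u`. -/
noncomputable def symmSecondDiff (χ : ℝ → ℝ) (u s : ℝ) : ℝ :=
  χ (u + s) + χ (u - s) - 2 * χ u

theorem symmSecondDiff_zero (χ : ℝ → ℝ) (u : ℝ) : symmSecondDiff χ u 0 = 0 := by
  simp [symmSecondDiff]; ring

theorem hasDerivAt_symmSecondDiff {χ : ℝ → ℝ} {T u s : ℝ}
    (hdiff : ∀ x ∈ Set.Ici T, DifferentiableAt ℝ χ x) (hs : s ∈ Set.Icc 0 (u - T)) :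
    HasDerivAt (symmSecondDiff χ u) (deriv χ (u + s) - deriv χ (u - s)) s := by
  have h1 : HasDerivAt (fun s => χ (u + s)) (deriv χ (u + s)) s := by
    have := (hdiff (u + s) (by
      have := hs.1; have := hs.2
      show T ≤ u + s
      linarith)).hasDerivAt
    exact this.comp_const_add u s
  have h2 : HasDerivAt (fun s => χ (u - s)) (-deriv χ (u - s)) s := by
    have := (hdiff (u - s) (by
      have := hs.1; have := hs.2
      show T ≤ u - s
      linarith)).hasDerivAt
    exact this.comp_const_sub u s
  have := (h1.add h2).sub_const (2 * χ u)
  rw [← sub_eq_add_neg] at this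
  exact this

theorem symmSecondDiff_antitoneOn {χ : ℝ → ℝ} {T u : ℝ}
    (hdiff : ∀ x ∈ Set.Ici T, DifferentiableAt ℝ χ x) (hanti : AntitoneOn (deriv χ) (Set.Ici T)) :
    AntitoneOn (symmSecondDiff χ u) (Set.Icc 0 (u - T)) := by
  refine antitoneOn_of_deriv_nonpos (convex_Icc _ _)
    (fun s hs => (hasDerivAt_symmSecondDiff hdiff hs).continuousAt.continuousWithinAt)
    (fun s hs => (hasDerivAt_symmSecondDiff hdiff
      (interior_subset hs)).differentiableAt.differentiableWithinAt) fun s hs => ?_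
  have hs' := interior_subset hs
  rw [(hasDerivAt_symmSecondDiff hdiff hs').deriv]
  have := hs'.1
  have := hs'.2
  exact sub_nonpos.2 (hanti (show T ≤ u - s by linarith) (show T ≤ u + s by linarith) (by linarith))

theorem intervalIntegrable_deriv_add {χ : ℝ → ℝ} {T u L : ℝ} (hL : 0 ≤ L) (hu : L ≤ u - T)
    (hanti : AntitoneOn (deriv χ) (Set.Ici T)) :
    IntervalIntegrable (fun s => deriv χ (u + s)) volume 0 L := by
  apply AntitoneOn.intervalIntegrable
  rw [Set.uIcc_of_le hL]
  intro a ha b hb hab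
  have := ha.1
  have := hb.1
  exact hanti (show T ≤ u + a by linarith) (show T ≤ u + b by linarith) (by linarith)

theorem intervalIntegrable_deriv_sub {χ : ℝ → ℝ} {T u L : ℝ} (hL : 0 ≤ L) (hu : L ≤ u - T)
    (hanti : AntitoneOn (deriv χ) (Set.Ici T)) :
    IntervalIntegrable (fun s => deriv χ (u - s)) volume 0 L := by
  apply MonotoneOn.intervalIntegrable
  rw [Set.uIcc_of_le hL]
  intro a ha b hb hab
  have := ha.2
  have := hb.2
  exact hanti (show T ≤ u - b by linarith) (show T ≤ u - a by linarith) (by linarith)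

/-- The normalised convolution tail as a symmetric integral. The term `-1` left by the
decomposition of the convolution is itself the integral of `d/ds exp (symmSecondDiff χ u s)`, up to
the endpoint value; absorbing it turns `2 (α - χ' (u + s))` into
`2 α - χ' (u + s) - χ' (u - s)`. -/
theorem abs_convRatio_sub_integral_le (μ : Measure ℝ) [IsProbabilityMeasure μ] {α T u : ℝ}
    {χ : ℝ → ℝ} (hT : 0 < T) (hTu : T ≤ u)
    (htail : ∀ t : ℝ, 0 ≤ t → distTail μ t = Real.exp (-α * t + χ t))
    (hdiff : ∀ x ∈ Set.Ici T, DifferentiableAt ℝ χ x) (hanti : AntitoneOn (deriv χ) (Set.Ici T))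
    (hα : ∀ x ∈ Set.Ici T, deriv χ x ≤ α) :
    |distTail (Measure.conv μ μ) (2 * u) / distTail μ u ^ 2
        - ∫ s in (0 : ℝ)..u - T, (2 * α - deriv χ (u + s) - deriv χ (u - s))
          * Real.exp (symmSecondDiff χ u s)|
      ≤ (2 / distTail μ T + 1) * Real.exp (symmSecondDiff χ u (u - T)) := by
  have hL0 : 0 ≤ u - T := sub_nonneg.2 hTu
  have hpos : ∀ t, 0 ≤ t → 0 < distTail μ t := fun t ht => by rw [htail t ht]; exact Real.exp_pos _
  have hprod : ∀ s ∈ Set.Icc 0 (u - T), distTail μ (u + s) * distTail μ (u - s)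
      = distTail μ u ^ 2 * Real.exp (symmSecondDiff χ u s) := by
    intro s hs
    have := hs.1
    have := hs.2
    rw [htail _ (by linarith), htail _ (by linarith), htail _ (by linarith), ← Real.exp_nat_mul,
      ← Real.exp_add, ← Real.exp_add]
    congr 1
    simp only [symmSecondDiff]
    push_cast
    ring
  have hd : ∀ x ∈ Set.Ici T, HasDerivAt (distTail μ) (-((α - deriv χ x) * distTail μ x)) x := by
    intro x hx
    have hx0 : 0 < x := hT.trans_le hx
    have h1 : HasDerivAt (fun t => Real.exp (-α * t + χ t))
        (Real.exp (-α * x + χ x) * (-α * 1 + deriv χ x)) x :=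
      (((hasDerivAt_id x).const_mul (-α)).add (hdiff x hx).hasDerivAt).exp
    rw [htail x hx0.le, show -((α - deriv χ x) * Real.exp (-α * x + χ x))
      = Real.exp (-α * x + χ x) * (-α * 1 + deriv χ x) by ring]
    refine h1.congr_of_eventuallyEq ?_
    filter_upwards [lt_mem_nhds hx0] with t ht using htail t ht.le
  have hicc : Set.uIcc u (2 * u - T) ⊆ Set.Ici T := by
    rw [Set.uIcc_of_le (by linarith)]
    exact fun x hx => hTu.trans hx.1
  have hfi : IntervalIntegrable (fun x => (α - deriv χ x) * distTail μ x) volume u (2 * u - T) := by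
    refine IntervalIntegrable.mul_continuousOn ?_ fun x hx =>
      (hd x (hicc hx)).continuousAt.continuousWithinAt
    exact intervalIntegrable_const.sub (hanti.mono hicc).intervalIntegrable
  have hmain := abs_distTail_conv_self_sub_le μ hTu (f := fun x => (α - deriv χ x) * distTail μ x)
    (fun x hx => hd x (hTu.trans hx.1))
    (fun x hx => mul_nonneg (sub_nonneg.2 (hα x (hTu.trans hx.1))) (distTail_nonneg μ x)) hfi
  have huI : Set.uIcc 0 (u - T) = Set.Icc 0 (u - T) := Set.uIcc_of_le hL0
  have hgd : ∀ s ∈ Set.uIcc 0 (u - T), HasDerivAt (fun s => Real.exp (symmSecondDiff χ u s))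
      (Real.exp (symmSecondDiff χ u s) * (deriv χ (u + s) - deriv χ (u - s))) s := fun s hs =>
    (hasDerivAt_symmSecondDiff hdiff (huI ▸ hs)).exp
  have hgc : ContinuousOn (fun s => Real.exp (symmSecondDiff χ u s)) (Set.uIcc 0 (u - T)) :=
    fun s hs => (hgd s hs).continuousAt.continuousWithinAt
  have hia := intervalIntegrable_deriv_add hL0 le_rfl hanti
  have his := intervalIntegrable_deriv_sub hL0 le_rfl hanti
  have e1 : ∫ s in (0 : ℝ)..u - T, (α - deriv χ (u + s)) * distTail μ (u + s) * distTail μ (u - s)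
      = distTail μ u ^ 2 * ∫ s in (0 : ℝ)..u - T,
        (α - deriv χ (u + s)) * Real.exp (symmSecondDiff χ u s) := by
    rw [← intervalIntegral.integral_const_mul]
    refine intervalIntegral.integral_congr fun s hs => ?_
    rw [mul_assoc, hprod s (huI ▸ hs)]
    ring
  have e2 : ∫ s in (0 : ℝ)..u - T,
      Real.exp (symmSecondDiff χ u s) * (deriv χ (u + s) - deriv χ (u - s))
      = Real.exp (symmSecondDiff χ u (u - T)) - 1 := by
    rw [intervalIntegral.integral_eq_sub_of_hasDerivAt hgd ((hia.sub his).continuousOn_mul hgc),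
      symmSecondDiff_zero, Real.exp_zero]
  -- adding the exact integral of the derivative of the exponential symmetrises the integrand
  have e3 : ∫ s in (0 : ℝ)..u - T, (2 * α - deriv χ (u + s) - deriv χ (u - s))
        * Real.exp (symmSecondDiff χ u s)
      = 2 * (∫ s in (0 : ℝ)..u - T, (α - deriv χ (u + s)) * Real.exp (symmSecondDiff χ u s))
        + (Real.exp (symmSecondDiff χ u (u - T)) - 1) := by
    rw [← e2, ← intervalIntegral.integral_const_mul, ← intervalIntegral.integral_add]
    · refine intervalIntegral.integral_congr fun s _ => ?_
      ring
    · exact ((intervalIntegrable_const.sub hia).mul_continuousOn hgc).const_mul 2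
    · exact (hia.sub his).continuousOn_mul hgc
  have hPu := hpos u (by linarith)
  have hPT := hpos T hT.le
  have e4 := hprod (u - T) ⟨hL0, le_rfl⟩
  rw [show u + (u - T) = 2 * u - T by ring, sub_sub_cancel] at e4
  have e5 : distTail μ (2 * u - T) / distTail μ u ^ 2
      = Real.exp (symmSecondDiff χ u (u - T)) / distTail μ T := by
    rw [div_eq_div_iff (by positivity) hPT.ne', e4]; ring
  rw [e1] at hmain
  rw [e3]
  set J := ∫ s in (0 : ℝ)..u - T, (α - deriv χ (u + s)) * Real.exp (symmSecondDiff χ u s)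
  set Q := distTail (Measure.conv μ μ) (2 * u)
  have e6 : |Q / distTail μ u ^ 2 - (2 * J - 1)| ≤ 2 * (Real.exp (symmSecondDiff χ u (u - T))
      / distTail μ T) := by
    rw [← e5, ← mul_div_assoc, le_div_iff₀ (by positivity)]
    refine le_trans (le_of_eq ?_) hmain
    rw [← abs_of_pos (show 0 < distTail μ u ^ 2 by positivity), ← abs_mul,
      abs_of_pos (show 0 < distTail μ u ^ 2 by positivity)]
    congr 1
    field_simp
  have e7 : Q / distTail μ u ^ 2 - (2 * J + (Real.exp (symmSecondDiff χ u (u - T)) - 1))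
      = (Q / distTail μ u ^ 2 - (2 * J - 1)) - Real.exp (symmSecondDiff χ u (u - T)) := by ring
  rw [e7]
  refine (abs_sub _ _).trans ?_
  rw [Real.abs_exp]
  have e8 : (2 / distTail μ T + 1) * Real.exp (symmSecondDiff χ u (u - T))
      = 2 * (Real.exp (symmSecondDiff χ u (u - T)) / distTail μ T)
        + Real.exp (symmSecondDiff χ u (u - T)) := by ring
  rw [e8]
  linarith

/-- Only the part of the integral with `|s| ≤ η u` matters, up to an error governed by the
exponent at `η u`. -/
theorem abs_convRatio_sub_scaled_integral_le (μ : Measure ℝ) [IsProbabilityMeasure μ]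
    {α T u η : ℝ} {χ : ℝ → ℝ} (hT : 0 < T) (hη : 0 ≤ η) (hTu : u * η ≤ u - T) (hu : 0 < u)
    (htail : ∀ t : ℝ, 0 ≤ t → distTail μ t = Real.exp (-α * t + χ t))
    (hdiff : ∀ x ∈ Set.Ici T, DifferentiableAt ℝ χ x) (hanti : AntitoneOn (deriv χ) (Set.Ici T))
    (hα : ∀ x ∈ Set.Ici T, deriv χ x ≤ α) (h0 : ∀ x ∈ Set.Ici T, 0 ≤ deriv χ x) :
    |distTail (Measure.conv μ μ) (2 * u) / distTail μ u ^ 2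
        - u * ∫ y in (0 : ℝ)..η, (2 * α - deriv χ (u + u * y) - deriv χ (u - u * y))
          * Real.exp (symmSecondDiff χ u (u * y))|
      ≤ (2 / distTail μ T + 1 + 2 * α * u) * Real.exp (symmSecondDiff χ u (u * η)) := by
  have huη : 0 ≤ u * η := by positivity
  have hL0 : 0 ≤ u - T := huη.trans hTu
  have huI : Set.uIcc 0 (u - T) = Set.Icc 0 (u - T) := Set.uIcc_of_le hL0
  have hα0 : 0 ≤ α := (h0 T (le_refl T)).trans (hα T (le_refl T))
  have h1 := abs_convRatio_sub_integral_le μ hT (show T ≤ u by linarith) htail hdiff hanti hα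
  set F : ℝ → ℝ := fun s => (2 * α - deriv χ (u + s) - deriv χ (u - s))
          * Real.exp (symmSecondDiff χ u s) with hF
  have hmono := symmSecondDiff_antitoneOn (u := u) hdiff hanti
  have hFi : IntervalIntegrable F volume 0 (u - T) := by
    refine IntervalIntegrable.mul_continuousOn ?_ ?_
    · exact (intervalIntegrable_const.sub (intervalIntegrable_deriv_add hL0 le_rfl hanti)).sub
        (intervalIntegrable_deriv_sub hL0 le_rfl hanti)
    · intro s hs
      exact (hasDerivAt_symmSecondDiff hdiff (huI ▸ hs)).exp.continuousAt.continuousWithinAt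
  have hsc : u * ∫ y in (0 : ℝ)..η, F (u * y) = ∫ s in (0 : ℝ)..u * η, F s := by
    have := intervalIntegral.mul_integral_comp_mul_left (f := F) (a := 0) (b := η) (c := u)
    rwa [mul_zero] at this
  have hFi1 : IntervalIntegrable F volume 0 (u * η) := hFi.mono_set (by
    rw [huI, Set.uIcc_of_le huη]; exact Set.Icc_subset_Icc_right hTu)
  have hFi2 : IntervalIntegrable F volume (u * η) (u - T) := hFi.mono_set (by
    rw [huI, Set.uIcc_of_le hTu]; exact Set.Icc_subset_Icc_left huη)
  have hsplit := intervalIntegral.integral_add_adjacent_intervals hFi1 hFi2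
  have hrest : |∫ s in u * η..u - T, F s|
      ≤ 2 * α * u * Real.exp (symmSecondDiff χ u (u * η)) := by
    have := intervalIntegral.norm_integral_le_of_norm_le_const (f := F) (a := u * η) (b := u - T)
      (C := 2 * α * Real.exp (symmSecondDiff χ u (u * η))) ?_
    · rw [Real.norm_eq_abs] at this
      refine this.trans ?_
      rw [abs_of_nonneg (sub_nonneg.2 hTu)]
      have hle : u - T - u * η ≤ u := by linarith
      have := mul_le_mul_of_nonneg_left hle
        (show 0 ≤ 2 * α * Real.exp (symmSecondDiff χ u (u * η)) by positivity)
      linarith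
    · intro s hs
      rw [Set.uIoc_of_le hTu] at hs
      have ha : T ≤ u + s := by linarith [hs.1]
      have hb : T ≤ u - s := by linarith [hs.2]
      have a1 := h0 _ ha
      have a2 := h0 _ hb
      have a3 := hα _ ha
      have a4 := hα _ hb
      rw [hF, norm_mul, Real.norm_of_nonneg (by linarith), Real.norm_of_nonneg (Real.exp_pos _).le]
      refine mul_le_mul (by linarith) (Real.exp_le_exp.2 ?_) (Real.exp_pos _).le (by linarith)
      exact hmono ⟨huη, hTu⟩ ⟨huη.trans hs.1.le, hs.2⟩ hs.1.le
  have hlast : Real.exp (symmSecondDiff χ u (u - T)) ≤ Real.exp (symmSecondDiff χ u (u * η)) :=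
    Real.exp_le_exp.2 (hmono ⟨huη, hTu⟩ ⟨hL0, le_rfl⟩ hTu)
  have hPT : 0 < distTail μ T := by rw [htail T hT.le]; exact Real.exp_pos _
  have hlast' := mul_le_mul_of_nonneg_left hlast (show 0 ≤ 2 / distTail μ T + 1 by positivity)
  have hfin : u * ∫ y in (0 : ℝ)..η, (2 * α - deriv χ (u + u * y) - deriv χ (u - u * y))
          * Real.exp (symmSecondDiff χ u (u * y)) = ∫ s in (0 : ℝ)..u * η, F s := hsc
  rw [hfin, ← sub_eq_of_eq_add hsplit.symm]
  rw [abs_le] at h1 hrest ⊢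
  constructor <;> linarith [h1.1, h1.2, hrest.1, hrest.2]

/-! ### Comparison with the pure power exponent -/

/-- Integration by parts against the derivative of `exp D` with `D` decreasing: the bound involves
only the size of the primitive `E`, not of `E'`. -/
theorem abs_integral_deriv_mul_exp_le {E D E' D' : ℝ → ℝ} {η δ : ℝ} (hη : 0 ≤ η)
    (hE : ∀ y ∈ Set.Icc 0 η, HasDerivAt E (E' y) y) (hD : ∀ y ∈ Set.Icc 0 η, HasDerivAt D (D' y) y)
    (hE'i : IntervalIntegrable E' volume 0 η) (hD'i : IntervalIntegrable D' volume 0 η)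
    (hD' : ∀ y ∈ Set.Icc 0 η, D' y ≤ 0) (hE0 : E 0 = 0) (hD0 : D 0 = 0)
    (hδ : ∀ y ∈ Set.Icc 0 η, |E y| ≤ δ) :
    |∫ y in (0 : ℝ)..η, E' y * Real.exp (D y)| ≤ δ := by
  have huI : Set.uIcc 0 η = Set.Icc 0 η := Set.uIcc_of_le hη
  have hX : ∀ y ∈ Set.uIcc 0 η, HasDerivAt (fun y => Real.exp (D y)) (Real.exp (D y) * D' y) y :=
    fun y hy => (hD y (huI ▸ hy)).exp
  have hXc : ContinuousOn (fun y => Real.exp (D y)) (Set.uIcc 0 η) := fun y hy =>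
    (hX y hy).continuousAt.continuousWithinAt
  have hXi : IntervalIntegrable (fun y => Real.exp (D y) * D' y) volume 0 η :=
    hD'i.continuousOn_mul hXc
  have hparts := intervalIntegral.integral_mul_deriv_eq_deriv_mul
    (fun y hy => hE y (huI ▸ hy)) hX hE'i hXi
  have hone : ∫ y in (0 : ℝ)..η, Real.exp (D y) * D' y = Real.exp (D η) - 1 := by
    rw [intervalIntegral.integral_eq_sub_of_hasDerivAt hX hXi, hD0, Real.exp_zero]
  have hb : |∫ y in (0 : ℝ)..η, E y * (Real.exp (D y) * D' y)| ≤ δ * (1 - Real.exp (D η)) := by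
    have h1 : δ * (1 - Real.exp (D η)) = ∫ y in (0 : ℝ)..η, -δ * (Real.exp (D y) * D' y) := by
      rw [intervalIntegral.integral_const_mul, hone]; ring
    rw [h1, ← Real.norm_eq_abs]
    refine intervalIntegral.norm_integral_le_of_norm_le hη ?_ (hXi.const_mul _)
    filter_upwards with y hy
    have hy' := Set.Ioc_subset_Icc_self hy
    rw [norm_mul, Real.norm_eq_abs, Real.norm_eq_abs,
      abs_of_nonpos (mul_nonpos_of_nonneg_of_nonpos (Real.exp_pos _).le (hD' y hy'))]
    have := mul_le_mul_of_nonneg_right (hδ y hy')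
      (neg_nonneg.2 (mul_nonpos_of_nonneg_of_nonpos (Real.exp_pos (D y)).le (hD' y hy')))
    linarith
  have hEη := hδ η ⟨hη, le_rfl⟩
  have hEη' : |E η * Real.exp (D η)| ≤ δ * Real.exp (D η) := by
    rw [abs_mul, Real.abs_exp]
    exact mul_le_mul_of_nonneg_right hEη (Real.exp_pos _).le
  rw [hE0, zero_mul, sub_zero] at hparts
  have : ∫ y in (0 : ℝ)..η, E' y * Real.exp (D y)
      = E η * Real.exp (D η) - ∫ y in (0 : ℝ)..η, E y * (Real.exp (D y) * D' y) := by linarith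
  rw [this]
  refine (abs_sub _ _).trans ?_
  linarith

/-- Replace `χ (u ± u y)` by `χ u * (1 ± y) ^ ρ` in the symmetric integral, given that the
replacement is accurate to `δ`. No accuracy is assumed for `χ'`: it enters only through the odd
part `χ (u + u y) - χ (u - u y)`, which is integrated by parts. -/
theorem abs_scaled_integral_sub_le {α ρ c K M T u η δ : ℝ} {χ : ℝ → ℝ} (hα : 0 ≤ α) (hρ : 0 ≤ ρ)
    (hc : 0 < c) (hK : 0 ≤ K) (hη : 0 ≤ η) (hη1 : η < 1) (hu : 0 < u) (hTu : u * η ≤ u - T)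
    (hV : 0 < χ u) (hδ : δ ≤ 1 / 2)
    (hdiff : ∀ x ∈ Set.Ici T, DifferentiableAt ℝ χ x) (hanti : AntitoneOn (deriv χ) (Set.Ici T))
    (hp : ∀ y ∈ Set.Icc 0 η, |χ (u + u * y) - χ u * (1 + y) ^ ρ| ≤ δ)
    (hm : ∀ y ∈ Set.Icc 0 η, |χ (u - u * y) - χ u * (1 - y) ^ ρ| ≤ δ)
    (hq : ∀ y ∈ Set.Icc 0 η, (1 + y) ^ ρ + (1 - y) ^ ρ - 2 ≤ -c * y ^ 2)
    (hb : ∀ y ∈ Set.Icc 0 η, |(1 + y) ^ (ρ - 1) + (1 - y) ^ (ρ - 1) - 2| ≤ K * y ^ 2)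
    (hM : √(χ u) * ∫ y in (0 : ℝ)..η, y ^ 2 * Real.exp (-c * χ u * y ^ 2) ≤ M / χ u) :
    |√(χ u) / 2 * (∫ y in (0 : ℝ)..η, (2 * α - deriv χ (u + u * y) - deriv χ (u - u * y))
          * Real.exp (symmSecondDiff χ u (u * y)))
        - (α - ρ * (χ u / u)) * (√(χ u) * ∫ y in (0 : ℝ)..η,
          Real.exp (χ u * ((1 + y) ^ ρ + (1 - y) ^ ρ - 2)))|
      ≤ α * (4 * δ * (√(Real.pi / c) / 2)) + √(χ u) / u * δ
        + ρ * (χ u / u) * (4 * δ * (√(Real.pi / c) / 2) + 3 / 2 * K * (M / χ u)) := by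
  set V := χ u with hVdef
  have hδ0 : 0 ≤ δ := (abs_nonneg _).trans (hp 0 ⟨le_rfl, hη⟩)
  have huI : Set.uIcc 0 η = Set.Icc 0 η := Set.uIcc_of_le hη
  set q : ℝ → ℝ := fun y => (1 + y) ^ ρ + (1 - y) ^ ρ - 2 with hqdef
  set b : ℝ → ℝ := fun y => ((1 + y) ^ (ρ - 1) + (1 - y) ^ (ρ - 1)) / 2 with hbdef
  set D : ℝ → ℝ := fun y => symmSecondDiff χ u (u * y) with hDdef
  have hmemL : ∀ y ∈ Set.Icc 0 η, u * y ∈ Set.Icc 0 (u - T) := fun y hy =>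
    ⟨mul_nonneg hu.le hy.1, (mul_le_mul_of_nonneg_left hy.2 hu.le).trans hTu⟩
  have hmul : ∀ y, HasDerivAt (fun y => u * y) u y := fun y => by
    simpa using (hasDerivAt_id y).const_mul u
  set D' : ℝ → ℝ := fun y => (deriv χ (u + u * y) - deriv χ (u - u * y)) * u with hD'def
  have hD : ∀ y ∈ Set.Icc 0 η, HasDerivAt D (D' y) y := fun y hy =>
    (hasDerivAt_symmSecondDiff hdiff (hmemL y hy)).comp y (hmul y)
  have hDc : ContinuousOn D (Set.uIcc 0 η) := fun y hy =>
    (hD y (huI ▸ hy)).continuousAt.continuousWithinAt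
  have hEc : ContinuousOn (fun y => Real.exp (D y)) (Set.uIcc 0 η) := hDc.rexp
  have hpos1 : ∀ y ∈ Set.Icc 0 η, 0 < 1 + y := fun y hy => by linarith [hy.1]
  have hpos2 : ∀ y ∈ Set.Icc 0 η, 0 < 1 - y := fun y hy => by linarith [hy.2]
  have hpowc : ∀ r : ℝ, ContinuousOn (fun y : ℝ => (1 + y) ^ r) (Set.uIcc 0 η) := fun r =>
    ContinuousOn.rpow_const (by fun_prop) fun y hy => Or.inl (hpos1 y (huI ▸ hy)).ne'
  have hpowc' : ∀ r : ℝ, ContinuousOn (fun y : ℝ => (1 - y) ^ r) (Set.uIcc 0 η) := fun r =>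
    ContinuousOn.rpow_const (by fun_prop) fun y hy => Or.inl (hpos2 y (huI ▸ hy)).ne'
  have hqc : ContinuousOn q (Set.uIcc 0 η) := ((hpowc ρ).add (hpowc' ρ)).sub continuousOn_const
  have hbc : ContinuousOn b (Set.uIcc 0 η) := ((hpowc _).add (hpowc' _)).div_const _
  have hXc : ContinuousOn (fun y => Real.exp (V * q y)) (Set.uIcc 0 η) :=
    (continuousOn_const.mul hqc).rexp
  have hia : IntervalIntegrable (fun y => deriv χ (u + u * y)) volume 0 η := by
    apply AntitoneOn.intervalIntegrable
    rw [huI]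
    intro y hy z hz hyz
    have h1 := hmemL y hy
    have h2 := hmemL z hz
    exact hanti (show T ≤ u + u * y by linarith [h1.1, h1.2])
      (show T ≤ u + u * z by linarith [h2.1, h2.2])
      (by linarith [mul_le_mul_of_nonneg_left hyz hu.le])
  have his : IntervalIntegrable (fun y => deriv χ (u - u * y)) volume 0 η := by
    apply MonotoneOn.intervalIntegrable
    rw [huI]
    intro y hy z hz hyz
    have h1 := hmemL y hy
    have h2 := hmemL z hz
    exact hanti (show T ≤ u - u * z by linarith [h2.1, h2.2])
      (show T ≤ u - u * y by linarith [h1.1, h1.2])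
      (by linarith [mul_le_mul_of_nonneg_left hyz hu.le])
  -- comparison of the exponents
  have hR : ∀ y ∈ Set.Icc 0 η, |D y - V * q y| ≤ 2 * δ := by
    intro y hy
    have e : D y - V * q y = (χ (u + u * y) - V * (1 + y) ^ ρ) + (χ (u - u * y) - V * (1 - y) ^ ρ) := by
      simp only [hDdef, hqdef, symmSecondDiff, ← hVdef]; ring
    rw [e]
    refine (abs_add_le _ _).trans ?_
    linarith [hp y hy, hm y hy]
  have hVq : ∀ y ∈ Set.Icc 0 η, Real.exp (V * q y) ≤ Real.exp (-c * V * y ^ 2) := fun y hy => by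
    apply Real.exp_le_exp.2
    have := mul_le_mul_of_nonneg_left (hq y hy) hV.le
    simp only [hqdef]
    linarith
  have hdiffexp : ∀ y ∈ Set.Icc 0 η, |Real.exp (D y) - Real.exp (V * q y)|
      ≤ 4 * δ * Real.exp (-c * V * y ^ 2) := by
    intro y hy
    have e : Real.exp (D y) - Real.exp (V * q y)
        = (Real.exp (D y - V * q y) - 1) * Real.exp (V * q y) := by
      rw [sub_mul, ← Real.exp_add]; simp
    rw [e, abs_mul, Real.abs_exp]
    have h1 := Real.abs_exp_sub_one_le ((hR y hy).trans (by linarith))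
    exact mul_le_mul (h1.trans (by linarith [hR y hy])) (hVq y hy) (Real.exp_pos _).le (by positivity)
  have hDbound : ∀ y ∈ Set.Icc 0 η, Real.exp (D y) ≤ 3 * Real.exp (-c * V * y ^ 2) := by
    intro y hy
    have := (abs_le.1 (hdiffexp y hy)).2
    have h3 := hVq y hy
    have h4 := Real.exp_pos (-c * V * y ^ 2)
    nlinarith
  have hbE : IntervalIntegrable (fun y => b y * Real.exp (D y)) volume 0 η :=
    (hbc.mul hEc).intervalIntegrable
  have hGc : Continuous fun y : ℝ => Real.exp (-c * V * y ^ 2) := by fun_prop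
  set J := √V * ∫ y in (0 : ℝ)..η, Real.exp (V * q y) with hJ
  set J₁ := √V * ∫ y in (0 : ℝ)..η, Real.exp (D y) with hJ₁
  set J₂ := √V * ∫ y in (0 : ℝ)..η, b y * Real.exp (D y) with hJ₂
  have hJJ₁ : |J₁ - J| ≤ 4 * δ * (√(Real.pi / c) / 2) := by
    rw [hJ, hJ₁, ← mul_sub, ← intervalIntegral.integral_sub hEc.intervalIntegrable
      hXc.intervalIntegrable, abs_mul, abs_of_nonneg (Real.sqrt_nonneg _)]
    have h1 : |∫ y in (0 : ℝ)..η, (Real.exp (D y) - Real.exp (V * q y))|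
        ≤ ∫ y in (0 : ℝ)..η, 4 * δ * Real.exp (-c * V * y ^ 2) := by
      rw [← Real.norm_eq_abs]
      refine intervalIntegral.norm_integral_le_of_norm_le hη ?_
        ((hGc.const_mul _).intervalIntegrable _ _)
      filter_upwards with y hy using hdiffexp y (Set.Ioc_subset_Icc_self hy)
    rw [intervalIntegral.integral_const_mul] at h1
    have h2 := sqrt_mul_integral_gaussian_le hc hη hV
    calc _ ≤ √V * (4 * δ * ∫ y in (0 : ℝ)..η, Real.exp (-c * V * y ^ 2)) :=
          mul_le_mul_of_nonneg_left h1 (Real.sqrt_nonneg _)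
      _ = 4 * δ * (√V * ∫ y in (0 : ℝ)..η, Real.exp (-c * V * y ^ 2)) := by ring
      _ ≤ _ := mul_le_mul_of_nonneg_left h2 (by positivity)
  have hJJ₂ : |J₂ - J₁| ≤ 3 / 2 * K * (M / V) := by
    rw [hJ₁, hJ₂, ← mul_sub, ← intervalIntegral.integral_sub hbE
      hEc.intervalIntegrable, abs_mul, abs_of_nonneg (Real.sqrt_nonneg _)]
    have h1 : |∫ y in (0 : ℝ)..η, (b y * Real.exp (D y) - Real.exp (D y))|
        ≤ ∫ y in (0 : ℝ)..η, 3 / 2 * K * (y ^ 2 * Real.exp (-c * V * y ^ 2)) := by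
      rw [← Real.norm_eq_abs]
      refine intervalIntegral.norm_integral_le_of_norm_le hη ?_
        ((((continuous_pow 2).mul hGc).const_mul _).intervalIntegrable _ _)
      filter_upwards with y hy
      have hy' := Set.Ioc_subset_Icc_self hy
      have e : b y * Real.exp (D y) - Real.exp (D y)
          = ((1 + y) ^ (ρ - 1) + (1 - y) ^ (ρ - 1) - 2) / 2 * Real.exp (D y) := by
        simp only [hbdef]; ring
      rw [e, norm_mul, Real.norm_eq_abs, Real.norm_eq_abs, Real.abs_exp, abs_div, abs_two]
      have h2 := mul_le_mul (hb y hy') (hDbound y hy') (Real.exp_pos _).le (by positivity)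
      linarith
    rw [intervalIntegral.integral_const_mul] at h1
    calc _ ≤ √V * (3 / 2 * K * ∫ y in (0 : ℝ)..η, y ^ 2 * Real.exp (-c * V * y ^ 2)) :=
          mul_le_mul_of_nonneg_left h1 (Real.sqrt_nonneg _)
      _ = 3 / 2 * K * (√V * ∫ y in (0 : ℝ)..η, y ^ 2 * Real.exp (-c * V * y ^ 2)) := by ring
      _ ≤ _ := mul_le_mul_of_nonneg_left hM (by positivity)
  -- the odd part, by parts
  set E : ℝ → ℝ := fun y => (χ (u + u * y) - V * (1 + y) ^ ρ) - (χ (u - u * y) - V * (1 - y) ^ ρ)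
    with hEdef
  set E' : ℝ → ℝ := fun y => u * (deriv χ (u + u * y) + deriv χ (u - u * y)) - 2 * ρ * V * b y
    with hE'def
  have hEd : ∀ y ∈ Set.Icc 0 η, HasDerivAt E (E' y) y := by
    intro y hy
    have hl := hmemL y hy
    have h1 : HasDerivAt (fun y => χ (u + u * y)) (deriv χ (u + u * y) * u) y :=
      (hdiff _ (show T ≤ u + u * y by linarith [hl.1, hl.2])).hasDerivAt.comp y
        ((hmul y).const_add u)
    have h2 : HasDerivAt (fun y => χ (u - u * y)) (deriv χ (u - u * y) * -u) y :=
      (hdiff _ (show T ≤ u - u * y by linarith [hl.1, hl.2])).hasDerivAt.comp y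
        ((hmul y).const_sub u)
    have h3 : HasDerivAt (fun y : ℝ => (1 + y) ^ ρ) (1 * ρ * (1 + y) ^ (ρ - 1)) y :=
      ((hasDerivAt_id y).const_add 1).rpow_const (Or.inl (hpos1 y hy).ne')
    have h4 : HasDerivAt (fun y : ℝ => (1 - y) ^ ρ) (-1 * ρ * (1 - y) ^ (ρ - 1)) y :=
      ((hasDerivAt_id y).const_sub 1).rpow_const (Or.inl (hpos2 y hy).ne')
    have := (h1.sub (h3.const_mul V)).sub (h2.sub (h4.const_mul V))
    refine this.congr_deriv ?_
    simp only [hE'def, hbdef]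
    ring
  have hodd : |∫ y in (0 : ℝ)..η, E' y * Real.exp (D y)| ≤ 2 * δ := by
    refine abs_integral_deriv_mul_exp_le hη hEd hD ?_ ((hia.sub his).mul_const u) ?_ ?_ ?_ ?_
    · exact ((hia.add his).const_mul u).sub (hbc.intervalIntegrable.const_mul _)
    · intro y hy
      have hl := hmemL y hy
      refine mul_nonpos_of_nonpos_of_nonneg (sub_nonpos.2 ?_) hu.le
      exact hanti (show T ≤ u - u * y by linarith [hl.1, hl.2])
        (show T ≤ u + u * y by linarith [hl.1, hl.2]) (by linarith [hl.1])
    · simp [hEdef]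
    · simp [hDdef, symmSecondDiff_zero]
    · intro y hy
      refine (abs_sub _ _).trans ?_
      linarith [hp y hy, hm y hy]
  have hsplit : √V / 2 * (∫ y in (0 : ℝ)..η, (2 * α - deriv χ (u + u * y) - deriv χ (u - u * y))
          * Real.exp (D y))
      = α * J₁ - √V / (2 * u) * (∫ y in (0 : ℝ)..η, E' y * Real.exp (D y)) - ρ * (V / u) * J₂ := by
    have e : ∫ y in (0 : ℝ)..η, (2 * α - deriv χ (u + u * y) - deriv χ (u - u * y))
          * Real.exp (D y)
        = ∫ y in (0 : ℝ)..η, (2 * α * Real.exp (D y) - u⁻¹ * (E' y * Real.exp (D y))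
          - u⁻¹ * (2 * ρ * V) * (b y * Real.exp (D y))) := by
      refine intervalIntegral.integral_congr fun y _ => ?_
      simp only [hE'def]
      field_simp
      ring
    have i1 : IntervalIntegrable (fun y => E' y * Real.exp (D y)) volume 0 η :=
      (((hia.add his).const_mul u).sub (hbc.intervalIntegrable.const_mul _)).mul_continuousOn hEc
    rw [e, intervalIntegral.integral_sub, intervalIntegral.integral_sub,
      intervalIntegral.integral_const_mul, intervalIntegral.integral_const_mul,
      intervalIntegral.integral_const_mul, hJ₁, hJ₂]
    · field_simp
    · exact hEc.intervalIntegrable.const_mul _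
    · exact i1.const_mul _
    · exact (hEc.intervalIntegrable.const_mul _).sub (i1.const_mul _)
    · exact hbE.const_mul _
  rw [hsplit]
  set O := ∫ y in (0 : ℝ)..η, E' y * Real.exp (D y)
  have hfin : α * J₁ - √V / (2 * u) * O - ρ * (V / u) * J₂ - (α - ρ * (V / u)) * J
      = α * (J₁ - J) - √V / (2 * u) * O - ρ * (V / u) * ((J₁ - J) + (J₂ - J₁)) := by ring
  rw [hfin]
  have t1 : |α * (J₁ - J)| ≤ α * (4 * δ * (√(Real.pi / c) / 2)) := by
    rw [abs_mul, abs_of_nonneg hα]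
    exact mul_le_mul_of_nonneg_left hJJ₁ hα
  have t2 : |√V / (2 * u) * O| ≤ √V / u * δ := by
    rw [abs_mul, abs_of_nonneg (by positivity)]
    calc _ ≤ √V / (2 * u) * (2 * δ) := mul_le_mul_of_nonneg_left hodd (by positivity)
      _ = _ := by field_simp
  have t3 : |ρ * (V / u) * ((J₁ - J) + (J₂ - J₁))|
      ≤ ρ * (V / u) * (4 * δ * (√(Real.pi / c) / 2) + 3 / 2 * K * (M / V)) := by
    rw [abs_mul, abs_of_nonneg (by positivity)]
    exact mul_le_mul_of_nonneg_left ((abs_add_le _ _).trans (add_le_add hJJ₁ hJJ₂)) (by positivity)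
  refine (abs_sub _ _).trans (add_le_add ((abs_sub _ _).trans (add_le_add t1 t2)) t3)

/-! ### Expansion of the normalised convolution tail -/

theorem IsSecondOrderRV.eventually_abs_sub_le {χ A : ℝ → ℝ} {a r T : ℝ}
    (h : IsSecondOrderRV χ a r A) (hr : r < 0) (hc : ContinuousOn χ (Set.Ioi T)) {ε : ℝ}
    (hε : 0 < ε) :
    ∃ η > 0, ∀ᶠ u in atTop, ∀ x, |x - 1| ≤ η → |χ (u * x) - χ u * x ^ a| ≤ ε * (|A u| * χ u) := by
  have h1 := (h.tendsto_prod hr hc).abs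
  rw [abs_zero] at h1
  obtain ⟨pa, hpa, pb, hpb, hab⟩ := eventually_prod_iff.1 (h1.eventually_lt_const hε)
  obtain ⟨η, hη, hball⟩ := Metric.eventually_nhds_iff.1 hpb
  refine ⟨η / 2, by positivity, ?_⟩
  filter_upwards [hpa, h.aux_ne_zero, h.eventually_pos] with u hu hA hχ x hx
  have hx' : dist x 1 < η := by rw [Real.dist_eq]; linarith
  have := (hab hu (hball hx')).le
  have hA' : 0 < |A u| := abs_pos.2 hA
  have e : χ (u * x) - χ u * x ^ a = (χ (u * x) / χ u - x ^ a) / A u * (A u * χ u) := by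
    field_simp
  rw [e, abs_mul, abs_mul (A u), abs_of_pos hχ]
  exact mul_le_mul_of_nonneg_right this (by positivity)

/-- The fourth-order coefficient of the even exponent, responsible for the `1 / χ` term. -/
theorem tendsto_two_sided_rpow (ρ : ℝ) :
    Tendsto (fun y : ℝ => ((1 + y) ^ ρ + (1 - y) ^ ρ - 2 + ρ * (1 - ρ) * y ^ 2) / y ^ 4) (𝓝[>] 0)
      (𝓝 (-(ρ * (1 - ρ) * (ρ - 2) * (ρ - 3) / 12))) := by
  have h := (two_sided_rpow_taylor_isBigO ρ).mono (nhdsWithin_le_nhds (s := Set.Ioi 0))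
  have h2 : (fun y : ℝ => ‖y‖ ^ 5) =o[𝓝[>] 0] fun y : ℝ => y ^ 4 := by
    have : (fun y : ℝ => ‖y‖ ^ 5) = fun y : ℝ => ‖y ^ 5‖ := by funext y; rw [norm_pow]
    rw [this]
    exact ((isLittleO_pow_pow (𝕜 := ℝ) (m := 4) (n := 5) (by norm_num)).mono
      nhdsWithin_le_nhds).norm_left
  have h3 := (h.trans_isLittleO h2).tendsto_div_nhds_zero.add_const
    (-(ρ * (1 - ρ) * (ρ - 2) * (ρ - 3) / 12))
  rw [zero_add] at h3
  refine h3.congr' ?_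
  filter_upwards [self_mem_nhdsWithin] with y hy
  have hy0 : y ≠ 0 := ne_of_gt hy
  field_simp
  ring

theorem exists_two_sided_rpow_bounds {ρ : ℝ} (hρ0 : 0 < ρ) (hρ1 : ρ < 1) :
    ∃ η₀ K : ℝ, 0 < η₀ ∧ η₀ < 1 ∧ 0 ≤ K ∧ ∀ y ∈ Set.Icc 0 η₀,
      (1 + y) ^ ρ + (1 - y) ^ ρ - 2 ≤ -(ρ * (1 - ρ) / 2) * y ^ 2 ∧
      |(1 + y) ^ ρ + (1 - y) ^ ρ - 2 + ρ * (1 - ρ) * y ^ 2| ≤ K * y ^ 4 ∧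
      |(1 + y) ^ (ρ - 1) + (1 - y) ^ (ρ - 1) - 2| ≤ K * y ^ 2 := by
  have hκ : 0 < ρ * (1 - ρ) := mul_pos hρ0 (by linarith)
  obtain ⟨K₁, hK₁⟩ : ∃ K₁, ∀ᶠ y in 𝓝[>] (0 : ℝ),
      |(1 + y) ^ ρ + (1 - y) ^ ρ - 2 + ρ * (1 - ρ) * y ^ 2| ≤ K₁ * y ^ 4 := by
    have h := (tendsto_two_sided_rpow ρ).abs
    refine ⟨|-(ρ * (1 - ρ) * (ρ - 2) * (ρ - 3) / 12)| + 1, ?_⟩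
    filter_upwards [h.eventually_lt_const (lt_add_one _), self_mem_nhdsWithin] with y hy hy0
    have : 0 < y ^ 4 := pow_pos hy0 4
    rw [abs_div, abs_of_pos this, div_lt_iff₀ this] at hy
    exact hy.le
  obtain ⟨K₂, hK₂⟩ := ((two_sided_rpow_isBigO_sq (ρ - 1)).mono
    (nhdsWithin_le_nhds (s := Set.Ioi (0 : ℝ)))).bound
  set K := max (max K₁ K₂) 0 with hK
  have hK0 : 0 ≤ K := le_max_right _ _
  have hsmall : ∀ᶠ y in 𝓝[>] (0 : ℝ), K * y ^ 2 < ρ * (1 - ρ) / 2 := by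
    have : Tendsto (fun y : ℝ => K * y ^ 2) (𝓝[>] 0) (𝓝 (K * 0 ^ 2)) :=
      ((by fun_prop : Continuous fun y : ℝ => K * y ^ 2).tendsto 0).mono_left nhdsWithin_le_nhds
    refine this.eventually_lt_const ?_
    simp only [ne_eq, OfNat.ofNat_ne_zero, not_false_eq_true, zero_pow, mul_zero]
    positivity
  obtain ⟨η, hη0, hη⟩ := mem_nhdsGT_iff_exists_Ioo_subset.1 (hK₁.and (hK₂.and hsmall))
  have hη0' : 0 < η := hη0
  refine ⟨min (η / 2) (1 / 2), K, lt_min (by positivity) (by norm_num),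
    (min_le_right _ _).trans_lt (by norm_num), hK0, fun y hy => ?_⟩
  rcases eq_or_lt_of_le hy.1 with h0 | h0
  · subst h0
    norm_num
  · obtain ⟨h1, h2, h3⟩ := hη ⟨h0, (hy.2.trans (min_le_left _ _)).trans_lt (by linarith)⟩
    have e1 : |(1 + y) ^ ρ + (1 - y) ^ ρ - 2 + ρ * (1 - ρ) * y ^ 2| ≤ K * y ^ 4 :=
      h1.trans (mul_le_mul_of_nonneg_right ((le_max_left _ _).trans (le_max_left _ _))
        (by positivity))
    refine ⟨?_, e1, ?_⟩
    · have := (abs_le.1 e1).2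
      have h4 := mul_le_mul_of_nonneg_right h3.le (sq_nonneg y)
      nlinarith
    · rw [Real.norm_eq_abs, Real.norm_eq_abs, abs_of_nonneg (sq_nonneg y)] at h2
      exact h2.trans (mul_le_mul_of_nonneg_right ((le_max_right _ _).trans (le_max_left _ _))
        (by positivity))

/-- Monotonicity of the tail bounds the slope of `χ`. -/
theorem deriv_le_of_distTail_eq {μ : Measure ℝ} [IsFiniteMeasure μ] {α x : ℝ} {χ : ℝ → ℝ}
    (htail : ∀ t : ℝ, 0 ≤ t → distTail μ t = Real.exp (-α * t + χ t)) (hx : 0 < x)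
    (hd : DifferentiableAt ℝ χ x) : deriv χ x ≤ α := by
  have hanti : AntitoneOn (fun t => -α * t + χ t) (Set.Ioi 0) := by
    intro a ha b hb hab
    have := antitone_distTail μ hab
    rw [htail a (le_of_lt ha), htail b (le_of_lt hb)] at this
    exact Real.exp_le_exp.1 this
  have h1 : HasDerivAt (fun t => -α * t + χ t) (-α * 1 + deriv χ x) x :=
    ((hasDerivAt_id x).const_mul (-α)).add hd.hasDerivAt
  have h2 := hanti.derivWithin_nonpos (x := x)
  rw [derivWithin_of_mem_nhds (Ioi_mem_nhds hx), h1.deriv] at h2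
  linarith

/-- A concave function that tends to infinity is nondecreasing. -/
theorem deriv_nonneg_of_tendsto_atTop {χ : ℝ → ℝ} {T x : ℝ}
    (hdiff : ∀ x ∈ Set.Ici T, DifferentiableAt ℝ χ x) (hanti : AntitoneOn (deriv χ) (Set.Ici T))
    (hχ : Tendsto χ atTop atTop) (hx : T ≤ x) : 0 ≤ deriv χ x := by
  by_contra hneg
  have h1 : AntitoneOn χ (Set.Ici x) := by
    refine antitoneOn_of_deriv_nonpos (convex_Ici x)
      (fun y hy => (hdiff y (hx.trans hy)).continuousAt.continuousWithinAt)
      (fun y hy => (hdiff y (hx.trans (interior_subset hy))).differentiableWithinAt) fun y hy => ?_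
    have hy' : x ≤ y := interior_subset hy
    exact (hanti hx (hx.trans hy') hy').trans (not_le.1 hneg).le
  obtain ⟨y, hy1, hy2⟩ := ((hχ.eventually_gt_atTop (χ x)).and (eventually_ge_atTop x)).exists
  exact absurd (h1 (le_refl x) hy2 hy2) (not_le.2 hy1)

set_option maxHeartbeats 1000000 in
/-- The asserted expansion with `u = t / 2` as the variable. Here the error does not need the term
`√χ / t`. -/
theorem convRatio_expansion
    (μ : Measure ℝ) [IsProbabilityMeasure μ] {α ρ ρ₁ T : ℝ} {χ A : ℝ → ℝ} (hT : 0 < T)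
    (htail : ∀ t : ℝ, 0 ≤ t → distTail μ t = Real.exp (-α * t + χ t))
    (hdiff : ∀ x ∈ Set.Ici T, DifferentiableAt ℝ χ x) (hanti : AntitoneOn (deriv χ) (Set.Ici T))
    (hρ0 : 0 < ρ) (hρ1 : ρ < 1) (hρρ₁ : ρ + ρ₁ < 0) (hχ : IsSecondOrderRV χ ρ ρ₁ A) :
    (fun u : ℝ => √(χ u) / (2 * u) * (distTail (Measure.conv μ μ) (2 * u) / distTail μ u ^ 2)
        - (α * (√(Real.pi / (ρ * (1 - ρ))) / 2)
          + α * (-(ρ * (1 - ρ) * (ρ - 2) * (ρ - 3) / 12)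
              * (3 / 8 * √Real.pi * (ρ * (1 - ρ)) ^ (-(5 / 2) : ℝ))) / χ u
          - ρ * (√(Real.pi / (ρ * (1 - ρ))) / 2) * (χ u / u)))
      =o[atTop] fun u : ℝ => |A u| * χ u + 1 / χ u := by
  have hr : ρ₁ < 0 := by linarith
  have hκ : 0 < ρ * (1 - ρ) := mul_pos hρ0 (by linarith)
  have hc : ContinuousOn χ (Set.Ioi T) := fun x hx =>
    (hdiff x (Set.Ioi_subset_Ici_self hx)).continuousAt.continuousWithinAt
  have hχtop := hχ.tendsto_atTop_of_pos hρ0 hc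
  have hχid := hχ.tendsto_div_id hρ1 hc
  have hAχ := hχ.tendsto_aux_mul hr hρρ₁ hc
  have hle : ∀ x ∈ Set.Ici T, deriv χ x ≤ α := fun x hx =>
    deriv_le_of_distTail_eq htail (hT.trans_le hx) (hdiff x hx)
  have hge : ∀ x ∈ Set.Ici T, 0 ≤ deriv χ x := fun x hx =>
    deriv_nonneg_of_tendsto_atTop hdiff hanti hχtop hx
  have hα : 0 ≤ α := (hge T Set.self_mem_Ici).trans (hle T Set.self_mem_Ici)
  obtain ⟨η₀, K, hη₀, hη₀1, hK, hbounds⟩ := exists_two_sided_rpow_bounds hρ0 hρ1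
  set κ := ρ * (1 - ρ) with hκdef
  set c := κ / 2 with hcdef
  have hc0 : 0 < c := by positivity
  obtain ⟨M, hM0, hM⟩ := sqrt_mul_integral_sq_gaussian_le hc0
  set G := √(Real.pi / κ) / 2 with hG
  set M₀ := √(Real.pi / c) / 2 with hM₀
  set c₄ := -(κ * (ρ - 2) * (ρ - 3) / 12) * (3 / 8 * √Real.pi * κ ^ (-(5 / 2) : ℝ)) with hc₄
  set C₀ := 2 / distTail μ T + 1 with hC₀
  have hPT : 0 < distTail μ T := by rw [htail T hT.le]; exact Real.exp_pos _
  have hC₀0 : 0 ≤ C₀ := by positivity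
  have hM₀0 : 0 ≤ M₀ := by positivity
  set B : ℝ := (4 * α * M₀ + 1 + 4 * ρ * M₀) + (1 + α + ρ * (|c₄| + 1) + ρ * (3 / 2 * K * M)) with hB
  have hB0 : 0 < B := by positivity
  suffices H : ∀ ε : ℝ, 0 < ε → ε ≤ 1 → ∀ᶠ u in atTop,
      |√(χ u) / (2 * u) * (distTail (Measure.conv μ μ) (2 * u) / distTail μ u ^ 2)
        - (α * G + α * c₄ / χ u - ρ * G * (χ u / u))| ≤ ε * B * (|A u| * χ u + 1 / χ u) by
    rw [isLittleO_iff]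
    intro C hC
    have h := H (min 1 (C / B)) (lt_min one_pos (by positivity)) (min_le_left _ _)
    filter_upwards [h, hχ.eventually_pos] with u hu hpos
    have hE : 0 ≤ |A u| * χ u + 1 / χ u := by positivity
    rw [Real.norm_eq_abs, Real.norm_of_nonneg hE]
    refine hu.trans (mul_le_mul_of_nonneg_right ?_ hE)
    calc min 1 (C / B) * B ≤ C / B * B := mul_le_mul_of_nonneg_right (min_le_right _ _) hB0.le
      _ = C := div_mul_cancel₀ _ hB0.ne'
  intro ε hε hε1
  -- `η` may depend on `ε`, but `B` must not: it is built from `c`, `K`, `M`, which come from `η₀`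
  obtain ⟨η₁, hη₁, huni⟩ := hχ.eventually_abs_sub_le hr hc hε
  set η := min η₀ η₁ with hη
  have hη0 : 0 < η := lt_min hη₀ hη₁
  have hη1 : η < 1 := (min_le_left _ _).trans_lt hη₀1
  have hb : ∀ y ∈ Set.Icc 0 η, _ := fun y hy => hbounds y ⟨hy.1, hy.2.trans (min_le_left _ _)⟩
  have hqc : ContinuousOn (fun y : ℝ => (1 + y) ^ ρ + (1 - y) ^ ρ - 2) (Set.Icc 0 η) := by
    refine (ContinuousOn.add ?_ ?_).sub continuousOn_const
    · exact ContinuousOn.rpow_const (by fun_prop) fun y _ => Or.inr hρ0.le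
    · exact ContinuousOn.rpow_const (by fun_prop) fun y _ => Or.inr hρ0.le
  have hlap := (tendsto_laplace_second_order hη0 hc0 (by rw [hcdef]; linarith) hK hqc
    (fun y hy => (hb y hy).1) (fun y hy => (hb y hy).2.1) (tendsto_two_sided_rpow ρ)).comp hχtop
  have hlap' : ∀ᶠ u in atTop, |χ u * (√(χ u) * (∫ y in (0 : ℝ)..η,
      Real.exp (χ u * ((1 + y) ^ ρ + (1 - y) ^ ρ - 2))) - G) - c₄| < ε := by
    have := (hlap.sub_const c₄).abs
    rw [sub_self, abs_zero] at this
    exact this.eventually_lt_const hε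
  -- controls the range `y ≥ η`, where the exponent is at most `1 - c * η ^ 2 * χ u`
  have htl : ∀ᶠ u in atTop, √(χ u) * (C₀ / 2 + α) * Real.exp (1 - c * η ^ 2 * χ u)
      ≤ ε * (1 / χ u) := by
    have hcη : 0 < c * η ^ 2 := by positivity
    have h1 := ((tendsto_rpow_mul_exp_neg_mul_atTop_nhds_zero (3 / 2) (c * η ^ 2) hcη).comp
      hχtop).const_mul ((C₀ / 2 + α) * Real.exp 1)
    rw [mul_zero] at h1
    filter_upwards [h1.eventually_lt_const hε, hχ.eventually_pos] with u h hpos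
    have e32 : χ u ^ (3 / 2 : ℝ) = χ u * √(χ u) := by
      rw [show (3 / 2 : ℝ) = 1 + 1 / 2 by norm_num, Real.rpow_add hpos, Real.rpow_one,
        Real.sqrt_eq_rpow]
    simp only [Function.comp_def, e32] at h
    rw [mul_one_div, le_div_iff₀ hpos, sub_eq_add_neg, Real.exp_add]
    refine le_trans (le_of_eq ?_) h.le
    rw [neg_mul]
    ring
  filter_upwards [huni, hlap', htl, hχtop.eventually_ge_atTop 1, hχid.eventually_lt_const hε,
    hAχ.eventually_lt_const (show (0 : ℝ) < 1 / 2 by norm_num), eventually_ge_atTop 1,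
    eventually_ge_atTop (T / (1 - η))] with u huni hlap htl hV1 hVu hAV hu1 huT
  have hu0 : 0 < u := by linarith
  have hV0 : 0 < χ u := by linarith
  have hTu : u * η ≤ u - T := by
    rw [div_le_iff₀ (by linarith)] at huT
    linarith
  have hδ : ε * (|A u| * χ u) ≤ 1 / 2 := by
    have : 0 ≤ |A u| * χ u := by positivity
    nlinarith
  have hp : ∀ y ∈ Set.Icc 0 η, |χ (u + u * y) - χ u * (1 + y) ^ ρ| ≤ ε * (|A u| * χ u) := by
    intro y hy
    have := huni (1 + y) (by
      rw [add_sub_cancel_left, abs_of_nonneg hy.1]; exact hy.2.trans (min_le_right _ _))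
    rwa [mul_add, mul_one] at this
  have hm : ∀ y ∈ Set.Icc 0 η, |χ (u - u * y) - χ u * (1 - y) ^ ρ| ≤ ε * (|A u| * χ u) := by
    intro y hy
    have := huni (1 - y) (by
      rw [sub_sub_cancel_left, abs_neg, abs_of_nonneg hy.1]; exact hy.2.trans (min_le_right _ _))
    rwa [mul_sub, mul_one] at this
  have s1 := abs_convRatio_sub_scaled_integral_le μ hT hη0.le hTu hu0 htail hdiff hanti hle hge
  have s2 := abs_scaled_integral_sub_le hα hρ0.le hc0 hK hη0.le hη1 hu0 hTu hV0 hδ hdiff hanti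
    hp hm (fun y hy => (hb y hy).1) (fun y hy => (hb y hy).2.2) (hM (χ u) η hη0.le hV0)
  set I := ∫ y in (0 : ℝ)..η, (2 * α - deriv χ (u + u * y) - deriv χ (u - u * y))
          * Real.exp (symmSecondDiff χ u (u * y))
  set J := √(χ u) * ∫ y in (0 : ℝ)..η, Real.exp (χ u * ((1 + y) ^ ρ + (1 - y) ^ ρ - 2))
  set W := distTail (Measure.conv μ μ) (2 * u) / distTail μ u ^ 2
  set V := χ u with hVdef
  set X := |A u| * V with hX
  have hX0 : 0 ≤ X := by positivity
  have hVu0 : 0 ≤ V / u := by positivity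
  have hDη : symmSecondDiff χ u (u * η) ≤ 1 - c * η ^ 2 * V := by
    have h1 := (abs_le.1 (hp η ⟨hη0.le, le_rfl⟩)).2
    have h2 := (abs_le.1 (hm η ⟨hη0.le, le_rfl⟩)).2
    have h3 := mul_le_mul_of_nonneg_left (hb η ⟨hη0.le, le_rfl⟩).1 hV0.le
    simp only [symmSecondDiff, ← hVdef]
    nlinarith
  have t1 : |√V / (2 * u) * W - √V / 2 * I| ≤ ε * (1 / V) := by
    have e : √V / (2 * u) * W - √V / 2 * I = √V / (2 * u) * (W - u * I) := by
      field_simp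
    rw [e, abs_mul, abs_of_nonneg (by positivity)]
    refine le_trans ?_ htl
    calc √V / (2 * u) * |W - u * I|
        ≤ √V / (2 * u) * ((C₀ + 2 * α * u) * Real.exp (1 - c * η ^ 2 * V)) := by
          refine mul_le_mul_of_nonneg_left (s1.trans ?_) (by positivity)
          exact mul_le_mul_of_nonneg_left (Real.exp_le_exp.2 hDη) (by positivity)
      _ = √V * (C₀ / (2 * u) + α) * Real.exp (1 - c * η ^ 2 * V) := by field_simp
      _ ≤ _ := by
          have : C₀ / (2 * u) ≤ C₀ / 2 := div_le_div_of_nonneg_left hC₀0 two_pos (by linarith)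
          gcongr
  have t2 : |√V / 2 * I - (α - ρ * (V / u)) * J|
      ≤ ε * (4 * α * M₀ + 1 + 4 * ρ * M₀) * X + ε * (ρ * (3 / 2 * K * M)) * (1 / V) := by
    refine s2.trans ?_
    have hsq : √V / u ≤ 1 := by
      have h1 : √V ≤ V := by
        rw [Real.sqrt_le_left hV0.le]; nlinarith
      have : √V / u ≤ V / u := div_le_div_of_nonneg_right h1 hu0.le
      linarith
    have a1 : √V / u * (ε * X) ≤ 1 * (ε * X) := mul_le_mul_of_nonneg_right hsq (by positivity)
    have a2 : V / u * (4 * (ε * X) * M₀) ≤ 1 * (4 * (ε * X) * M₀) :=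
      mul_le_mul_of_nonneg_right (by linarith) (by positivity)
    have a3 : V / u * (3 / 2 * K * (M / V)) ≤ ε * (3 / 2 * K * (M / V)) :=
      mul_le_mul_of_nonneg_right hVu.le (by positivity)
    have a4 := mul_le_mul_of_nonneg_left a2 hρ0.le
    have a5 := mul_le_mul_of_nonneg_left a3 hρ0.le
    have e : M / V = M * (1 / V) := by ring
    rw [e] at a5 ⊢
    calc _ = α * (4 * (ε * X) * M₀) + √V / u * (ε * X) + ρ * (V / u * (4 * (ε * X) * M₀))
            + ρ * (V / u * (3 / 2 * K * (M * (1 / V)))) := by ring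
      _ ≤ α * (4 * (ε * X) * M₀) + 1 * (ε * X) + ρ * (1 * (4 * (ε * X) * M₀))
            + ρ * (ε * (3 / 2 * K * (M * (1 / V)))) :=
          add_le_add (add_le_add (add_le_add le_rfl a1) a4) a5
      _ = _ := by ring
  have hJG : |J - G - c₄ / V| ≤ ε * (1 / V) := by
    have e : J - G - c₄ / V = (V * (J - G) - c₄) * (1 / V) := by field_simp
    rw [e, abs_mul, abs_of_pos (show 0 < 1 / V by positivity)]
    exact mul_le_mul_of_nonneg_right hlap.le (by positivity)
  have hJG' : |J - G| ≤ (|c₄| + 1) * (1 / V) := by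
    have e : J - G = (J - G - c₄ / V) + c₄ / V := by ring
    rw [e]
    refine (abs_add_le _ _).trans ?_
    have : |c₄ / V| = |c₄| * (1 / V) := by rw [abs_div, abs_of_pos hV0]; ring
    rw [this]
    have : ε * (1 / V) ≤ 1 * (1 / V) := mul_le_mul_of_nonneg_right hε1 (by positivity)
    linarith
  have t3 : |(α - ρ * (V / u)) * J - (α * G + α * c₄ / V - ρ * G * (V / u))|
      ≤ ε * (α + ρ * (|c₄| + 1)) * (1 / V) := by
    have e : (α - ρ * (V / u)) * J - (α * G + α * c₄ / V - ρ * G * (V / u))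
        = α * (J - G - c₄ / V) - ρ * (V / u) * (J - G) := by ring
    rw [e]
    refine (abs_sub _ _).trans ?_
    rw [abs_mul, abs_of_nonneg hα, abs_mul, abs_of_nonneg (by positivity : 0 ≤ ρ * (V / u))]
    have a1 := mul_le_mul_of_nonneg_left hJG hα
    have a2 : V / u * |J - G| ≤ ε * ((|c₄| + 1) * (1 / V)) :=
      mul_le_mul hVu.le hJG' (abs_nonneg _) hε.le
    have a3 := mul_le_mul_of_nonneg_left a2 hρ0.le
    calc _ = α * |J - G - c₄ / V| + ρ * (V / u * |J - G|) := by ring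
      _ ≤ α * (ε * (1 / V)) + ρ * (ε * ((|c₄| + 1) * (1 / V))) := add_le_add a1 a3
      _ = _ := by ring
  have htri : √V / (2 * u) * W - (α * G + α * c₄ / V - ρ * G * (V / u))
      = (√V / (2 * u) * W - √V / 2 * I) + (√V / 2 * I - (α - ρ * (V / u)) * J)
        + ((α - ρ * (V / u)) * J - (α * G + α * c₄ / V - ρ * G * (V / u))) := by ring
  rw [htri]
  refine (abs_add_three _ _ _).trans ?_
  have hY0 : 0 ≤ 1 / V := by positivity
  have f1 : 0 ≤ ε * (4 * α * M₀ + 1 + 4 * ρ * M₀) * (1 / V) := by positivity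
  have f2 : 0 ≤ ε * (1 + α + ρ * (|c₄| + 1) + ρ * (3 / 2 * K * M)) * X := by positivity
  refine (add_le_add (add_le_add t1 t2) t3).trans ?_
  refine (le_add_of_nonneg_right (add_nonneg f1 f2)).trans (le_of_eq ?_)
  rw [hB]
  ring

/-! ### Passage from `t / 2` to `t` -/

theorem IsSecondOrderRV.isBigO_error_half {χ A : ℝ → ℝ} {a r : ℝ} (h : IsSecondOrderRV χ a r A)
    (hr : r < 0) :
    (fun t : ℝ => |A (t / 2)| * χ (t / 2) + 1 / χ (t / 2))
      =O[atTop] fun t => |A t| * χ t + 1 / χ t := by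
  have h2 : (0 : ℝ) < 1 / 2 := by norm_num
  have hχr := h.tendsto_ratio h2
  have hAr := (h.tendsto_aux_ratio hr h2).abs
  have hχ0 : ((1 / 2 : ℝ) ^ a) ≠ 0 := (Real.rpow_pos_of_pos h2 a).ne'
  have l1 := hAr.mul hχr
  have l2 := hχr.inv₀ hχ0
  set C₁ := |(1 / 2 : ℝ) ^ r| * (1 / 2) ^ a
  set C₂ := ((1 / 2 : ℝ) ^ a)⁻¹
  have hmul := IsSecondOrderRV.tendsto_mul_const_atTop h2
  refine IsBigO.of_bound (max (C₁ + 1) (C₂ + 1)) ?_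
  filter_upwards [l1.eventually_lt_const (lt_add_one _), l2.eventually_lt_const (lt_add_one _),
    h.eventually_pos, hmul.eventually h.eventually_pos, h.aux_ne_zero] with t h1 h2 h3 h4 h5
  rw [mul_one_div] at h1 h2 h4
  have h5' : 0 < |A t| := abs_pos.2 h5
  rw [Real.norm_of_nonneg (by positivity), Real.norm_of_nonneg (by positivity), mul_add]
  refine add_le_add ?_ ?_
  · rw [abs_div, div_mul_div_comm, div_lt_iff₀ (by positivity)] at h1
    exact h1.le.trans (mul_le_mul_of_nonneg_right (le_max_left _ _) (by positivity))
  · rw [inv_div, div_lt_iff₀ h4] at h2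
    rw [mul_one_div, div_le_div_iff₀ h4 h3, one_mul]
    exact h2.le.trans (mul_le_mul_of_nonneg_right (le_max_right _ _) h4.le)

theorem IsSecondOrderRV.isLittleO_inv_half {χ A : ℝ → ℝ} {a r : ℝ} (h : IsSecondOrderRV χ a r A) :
    (fun t : ℝ => 1 / χ (t / 2) - 2 ^ a / χ t) =o[atTop] fun t => 1 / χ t := by
  have h2 : (0 : ℝ) < 1 / 2 := by norm_num
  have hl := (h.tendsto_ratio h2).inv₀ (Real.rpow_pos_of_pos h2 a).ne'
  have e : ((1 / 2 : ℝ) ^ a)⁻¹ = 2 ^ a := by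
    rw [one_div, Real.inv_rpow (by norm_num), inv_inv]
  rw [e] at hl
  have hl0 := hl.sub_const ((2 : ℝ) ^ a)
  rw [sub_self] at hl0
  refine (isLittleO_iff_tendsto' ?_).2 (hl0.congr' ?_)
  · filter_upwards [h.eventually_pos] with t ht h0
    exact absurd h0 (by positivity)
  · filter_upwards [h.eventually_pos,
      (IsSecondOrderRV.tendsto_mul_const_atTop h2).eventually h.eventually_pos] with t h3 h4
    rw [mul_one_div] at h4 ⊢
    field_simp

theorem IsSecondOrderRV.isLittleO_half_div_id {χ A : ℝ → ℝ} {a r : ℝ}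
    (h : IsSecondOrderRV χ a r A) :
    (fun t : ℝ => (χ (t / 2) - χ t / 2 ^ a) / t) =o[atTop] fun t => |A t| * χ t := by
  have h2 : (0 : ℝ) < 1 / 2 := by norm_num
  have hl := (h.tendsto (1 / 2) h2).mul tendsto_inv_atTop_zero
  rw [mul_zero] at hl
  have e : (1 / 2 : ℝ) ^ a = 1 / 2 ^ a := by
    rw [Real.div_rpow zero_le_one (by norm_num), Real.one_rpow]
  have hAχ : (fun t : ℝ => (χ (t / 2) - χ t / 2 ^ a) / t) =o[atTop] fun t => A t * χ t := by
    refine (isLittleO_iff_tendsto' ?_).2 (hl.congr' ?_)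
    · filter_upwards [h.eventually_pos, h.aux_ne_zero] with t ht hA h0
      exact absurd h0 (mul_ne_zero hA ht.ne')
    · filter_upwards [h.eventually_pos, h.aux_ne_zero, eventually_gt_atTop 0] with t ht hA h0
      rw [e, mul_one_div t]
      field_simp
  refine hAχ.trans_isBigO (IsBigO.of_bound 1 ?_)
  filter_upwards with t
  rw [norm_mul, norm_mul, Real.norm_eq_abs, Real.norm_eq_abs |A t|, abs_abs, one_mul]

theorem mainTheorem1
    (μ : Measure ℝ) [IsProbabilityMeasure μ] (hμ : μ (Set.Iio 0) = 0)
    (α ρ ρ₁ : ℝ) (χ A₁ : ℝ → ℝ)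
    (hα : 0 < α)
    (htail : ∀ t : ℝ, 0 ≤ t → distTail μ t = Real.exp (-α * t + χ t))
    (hχ' : ∃ t₀ : ℝ, (∀ t ∈ Set.Ioi t₀, DifferentiableAt ℝ χ t) ∧
      AntitoneOn (deriv χ) (Set.Ioi t₀))
    (hρ0 : 0 < ρ) (hρ1 : ρ < 1) (hρρ₁ : ρ + ρ₁ < 0)
    (hχ : IsSecondOrderRV χ ρ ρ₁ A₁) :
    (fun t : ℝ =>
        √(χ (t / 2)) * distTail (Measure.conv μ μ) t / (t * distTail μ (t / 2) ^ 2)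
          - (α / 2 * √(Real.pi / (ρ * (1 - ρ)))
              - (2 : ℝ) ^ (ρ - 5) * α * √Real.pi * (ρ - 2) * (ρ - 3)
                  / ((ρ * (1 - ρ)) ^ (3 / 2 : ℝ) * χ t)
              - 1 / (2 : ℝ) ^ ρ * √(ρ * Real.pi / (1 - ρ)) * (χ t / t)))
      =o[atTop] fun t : ℝ => |A₁ t| * χ t + 1 / χ t + √(χ t) / t := by
  obtain ⟨t₀, hd, ha⟩ := hχ'
  have hr : ρ₁ < 0 := by linarith
  have hκ : 0 < ρ * (1 - ρ) := mul_pos hρ0 (by linarith)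
  have hT : 0 < max t₀ 0 + 1 := by positivity
  have hsub : Set.Ici (max t₀ 0 + 1) ⊆ Set.Ioi t₀ := fun x hx =>
    (le_max_left t₀ 0).trans_lt ((lt_add_one _).trans_le hx)
  have hmain := convRatio_expansion μ hT htail (fun x hx => hd x (hsub hx)) (ha.mono hsub)
    hρ0 hρ1 hρρ₁ hχ
  have hhalf : Tendsto (fun t : ℝ => t / 2) atTop atTop := tendsto_id.atTop_div_const two_pos
  set κ := ρ * (1 - ρ) with hκdef
  set G := √(Real.pi / κ) / 2 with hG
  set c₄ := -(κ * (ρ - 2) * (ρ - 3) / 12) * (3 / 8 * √Real.pi * κ ^ (-(5 / 2) : ℝ)) with hc₄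
  have s1 := (hmain.comp_tendsto hhalf).trans_isBigO (hχ.isBigO_error_half hr)
  have hpos2 : ∀ᶠ t in atTop, 0 < χ (t / 2) := hhalf.eventually hχ.eventually_pos
  have hI : (fun t : ℝ => 1 / χ t) =O[atTop] fun t => |A₁ t| * χ t + 1 / χ t := by
    refine IsBigO.of_bound 1 ?_
    filter_upwards [hχ.eventually_pos] with t ht
    rw [Real.norm_of_nonneg (by positivity), Real.norm_of_nonneg (by positivity), one_mul]
    exact le_add_of_nonneg_left (by positivity)
  have hAI : (fun t : ℝ => |A₁ t| * χ t) =O[atTop] fun t => |A₁ t| * χ t + 1 / χ t := by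
    refine IsBigO.of_bound 1 ?_
    filter_upwards [hχ.eventually_pos] with t ht
    rw [Real.norm_of_nonneg (by positivity), Real.norm_of_nonneg (by positivity), one_mul]
    exact le_add_of_nonneg_right (by positivity)
  have s2 := (hχ.isLittleO_inv_half.trans_isBigO hI).const_mul_left (α * c₄)
  have s3 := (hχ.isLittleO_half_div_id.trans_isBigO hAI).const_mul_left (2 * ρ * G)
  have hfull : (fun t : ℝ => |A₁ t| * χ t + 1 / χ t)
      =O[atTop] fun t => |A₁ t| * χ t + 1 / χ t + √(χ t) / t := by
    refine IsBigO.of_bound 1 ?_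
    filter_upwards [hχ.eventually_pos, eventually_gt_atTop 0] with t ht h0
    rw [Real.norm_of_nonneg (by positivity), Real.norm_of_nonneg (by positivity), one_mul]
    exact le_add_of_nonneg_right (by positivity)
  refine (((s1.add s2).sub s3).trans_isBigO hfull).congr' ?_ EventuallyEq.rfl
  have hc₄' : c₄ * 2 ^ ρ = -((2 : ℝ) ^ (ρ - 5) * √Real.pi * (ρ - 2) * (ρ - 3) / κ ^ (3 / 2 : ℝ)) := by
    have e1 : κ ^ (-(5 / 2) : ℝ) = (κ ^ (3 / 2 : ℝ))⁻¹ * κ⁻¹ := by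
      rw [show (-(5 / 2) : ℝ) = -(3 / 2) + -1 by norm_num, Real.rpow_add hκ, Real.rpow_neg hκ.le,
        Real.rpow_neg_one]
    have e2 : (2 : ℝ) ^ (ρ - 5) = 2 ^ ρ / 32 := by
      rw [Real.rpow_sub two_pos]; norm_num
    have hκ32 : 0 < κ ^ (3 / 2 : ℝ) := Real.rpow_pos_of_pos hκ _
    rw [hc₄, e1, e2]
    field_simp
    ring
  have hG' : 2 * ρ * G = √(ρ * Real.pi / (1 - ρ)) := by
    have h1ρ : 0 < 1 - ρ := by linarith
    have e : ρ * Real.pi / (1 - ρ) = ρ ^ 2 * (Real.pi / κ) := by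
      rw [hκdef]; field_simp
    rw [e, Real.sqrt_mul (sq_nonneg ρ), Real.sqrt_sq hρ0.le, hG]
    ring
  filter_upwards [hχ.eventually_pos, hpos2, eventually_gt_atTop 0] with t h1 h2 h3
  have ht2 : 2 * (t / 2) = t := by ring
  simp only [Function.comp_def, ht2]
  have e1 : (2 : ℝ) ^ (ρ - 5) * α * √Real.pi * (ρ - 2) * (ρ - 3) / (κ ^ (3 / 2 : ℝ) * χ t)
      = -(α * (c₄ * 2 ^ ρ) / χ t) := by
    rw [hc₄']
    have hκ32 : 0 < κ ^ (3 / 2 : ℝ) := Real.rpow_pos_of_pos hκ _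
    field_simp
  have h2ρ : (0 : ℝ) < 2 ^ ρ := Real.rpow_pos_of_pos two_pos _
  rw [e1, ← hG', show α / 2 * √(Real.pi / κ) = α * G by rw [hG]; ring]
  have e2 : √(χ (t / 2)) / t * (distTail (Measure.conv μ μ) t / distTail μ (t / 2) ^ 2)
      = √(χ (t / 2)) * distTail (Measure.conv μ μ) t / (t * distTail μ (t / 2) ^ 2) :=
    div_mul_div_comm _ _ _ _
  rw [e2]
  field_simp
  ring
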